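/- Let $G$ be a connected simple graph of order $n\ge 6$. Its distance Laplacian is the real symmetric matrix $D^L(G)=\mathrm{Diag}(Tr)-D(G)$, where $D(G)$ is the distance matrix and $\mathrm{Diag}(Tr)$ is the diagonal matrix whose $v$-th entry is the sum of the distances from $v$ to all vertices. Let $\partial^L_1(G)\ge\partial^L_2(G)\ge\dots\ge\partial^L_n(G)$ be its eigenvalues, and let $m(\lambda)$ be the multiplicity of $\lambda$ as an eigenvalue of $D^L(G)$. Write $K_{t_1,\dots,t_l}$ for the complete multipartite graph with parts of sizes $t_1,\dots,t_l$; $SK_{n,\alpha}$ for the complement of the disjoint union of $K_\alpha$ and $n-\alpha$ isolated vertices; and $H+e$ for a graph obtained from $H$ by adding one edge between two distinct non-adjacent vertices (in each case below it is unique up to isomorphism). (a) $m(\partial^L_1(G))=n-4$, $\partial^L_{n-1}(G)=n$ and $m(n)=3$ hold if and only if at least one of the following holds: $n\equiv 0\pmod 4$ and $G\cong K_{\frac n4,\frac n4,\frac n4,\frac n4}$; $n\equiv 1\pmod 3$ and $G\cong K_{\frac{n-1}3,\frac{n-1}3,\frac{n-1}3,1}$; $n$ is even and $G\cong K_{\frac{n-2}2,\frac{n-2}2,1,1}$;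 $G\cong SK_{n,n-3}$. (b) $m(\partial^L_1(G))=n-4$, $\partial^L_{n-1}(G)=n$ and $m(n)=2$ hold if and only if at least one of the following holds: $G\cong SK_{n,n-2}+e$; $G$ is isomorphic to the complement of the disjoint union $K_{n-3}\cup K_2\cup K_1$; $G\cong K_{p,p,1}+e$ with $p=\frac{n-1}2$ an integer, $p\ge 3$; $G\cong K_{p,p,2}$ with $p=\frac{n-2}2$ an integer, $p\ge 3$; $G\cong K_{p,p,p}+e$ with $p=\frac n3$ an integer, $p\ge 3$. -/

import Mathlib

noncomputable section

namespace DistLap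

open Matrix

variable {V : Type*} [Fintype V] [DecidableEq V]

/-- The distance matrix `D(G)`. -/
def distMatrix (G : SimpleGraph V) : Matrix V V ℝ :=
  Matrix.of fun u v => (G.dist u v : ℝ)

/-- The transmission of a vertex: the sum of its distances to all vertices. -/
def transmission (G : SimpleGraph V) (v : V) : ℝ :=
  ∑ u : V, (G.dist u v : ℝ)

/-- The distance Laplacian matrix `D^L(G) = Diag(Tr) - D(G)`. -/
def distLaplacian (G : SimpleGraph V) : Matrix V V ℝ :=
  Matrix.diagonal (transmission G) - distMatrix G

theorem distLaplacian_isHermitian (G : SimpleGraph V) : (distLaplacian G).IsHermitian := by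
  ext u v
  rcases eq_or_ne u v with rfl | h
  · simp [distLaplacian]
  · simp [distLaplacian, distMatrix, Matrix.diagonal_apply_ne _ h,
      Matrix.diagonal_apply_ne _ h.symm, SimpleGraph.dist_comm]

/-- The distance Laplacian eigenvalues, repeated according to multiplicity, in nonincreasing
order. The index starts at `0`, so `eigenvalue G i` is the `(i+1)`-st largest eigenvalue. -/
def eigenvalue (G : SimpleGraph V) : Fin (Fintype.card V) → ℝ :=
  (distLaplacian_isHermitian G).eigenvalues₀

/-- The multiplicity of `x` as a distance Laplacian eigenvalue: the dimension of its eigenspace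
(the matrix is real symmetric, so geometric and algebraic multiplicities agree). -/
def multiplicity (G : SimpleGraph V) (x : ℝ) : ℕ :=
  Module.finrank ℝ (Module.End.eigenspace (Matrix.toLin' (distLaplacian G)) x)

end DistLap

/-- The complete multipartite graph with parts of sizes `t 0, …, t (l - 1)`. -/
def completeMultipartite {l : ℕ} (t : Fin l → ℕ) : SimpleGraph (Σ i : Fin l, Fin (t i)) :=
  SimpleGraph.completeMultipartiteGraph fun i : Fin l => Fin (t i)

/-- The complete split graph `SK_{n,α}` (for `α ≤ n`): the complement of the disjoint union of a
clique on `α` vertices and `n - α` isolated vertices. -/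
def completeSplit (n α : ℕ) : SimpleGraph (Fin α ⊕ Fin (n - α)) :=
  ((⊤ : SimpleGraph (Fin α)).sum (⊥ : SimpleGraph (Fin (n - α))))ᶜ

/-- The complement of the disjoint union `K_a ∪ K_b ∪ K_c`. -/
def complThreeCliques (a b c : ℕ) : SimpleGraph ((Fin a ⊕ Fin b) ⊕ Fin c) :=
  (((⊤ : SimpleGraph (Fin a)).sum (⊤ : SimpleGraph (Fin b))).sum (⊤ : SimpleGraph (Fin c)))ᶜ

/-- `G` is isomorphic to a graph `H + e`, obtained from `H` by adding one edge between two distinct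
non-adjacent vertices. -/
def IsIsoAddEdge {V W : Type*} (G : SimpleGraph V) (H : SimpleGraph W) : Prop :=
  ∃ u v : W, u ≠ v ∧ ¬ H.Adj u v ∧ Nonempty (G ≃g H ⊔ SimpleGraph.edge u v)

end

/-!
Let `H` be the complement of `G`, let `n` be the order of `G` and write `D` for the distance
Laplacian. The quadratic form of `D` is `½ ∑ d(u, v) (x u - x v)²`, and distances between distinct
vertices of `G` are at least one, with equality exactly off the edges of `H`. Hence the nonzero
eigenvalues of `D` are at least `n`, and the eigenspace of `n` consists of the functions of zero
sum that are constant on the components of `H` (`mem_eigspace_card_iff`). So `n` has multiplicity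
`k - 1`, where `k` is the number of components of `H`, and it is then automatically the second
smallest eigenvalue (`eigenvalue_card_sub_two`).

Suppose `k` is `3` or `4` and the largest eigenvalue `n + lam` has multiplicity `n - 4`. Let `J`
be the all-ones matrix and `P` the averaging over the components of `H`. The symmetric matrix
`(n + lam) I - J - lam P - D` kills the functions constant on components and the eigenvectors of
`n + lam`, so its rank is at most `4 - k`; as `n + lam` is the largest eigenvalue, it equals
`z zᵀ` for some vector `z` (`exists_fiberForm`), which vanishes exactly when `k = 4`. Since `G`
has diameter two, comparing entries shows that on a component of order `m` the products
`z u * z v` are `1 - lam / m` for pairs adjacent in `H` and `-lam / m` for the other pairs, while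
`z` sums to zero.

- If `2 ≤ m < lam`, all products are negative, which is impossible for three vertices, so `m = 2`.
- If `m ≥ 2` and `m > lam`, adjacency in `H` means having the same sign; by connectedness all
  signs agree, and `z` cannot sum to zero.
- If `m = lam ≥ 2`, the products are `0` on edges of `H` and `-1` on non-edges, so there is at
  most one non-edge.

Thus (`FiberForm.fiber_cases`) each component of `H` is a vertex, a complete graph on `lam`
vertices, or, for the single component on which `z` does not vanish, `K₂` or a complete graph on
`lam` vertices minus an edge. Conversely, such a graph has a distance Laplacian of the form
`(n + lam) I - J - lam P - z zᵀ` with an explicit `z` (`FiberForm.of_adj`), from which the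
multiplicity of the largest eigenvalue is read off. What remains is to sort the orders of the
components and to compare with the named graphs.
-/

namespace DistLap

open Matrix Module

/-! ### The quadratic form of the distance Laplacian -/

section Form

theorem sum_sum_sub_sq {V : Type*} [Fintype V] (x : V → ℝ) :
    ∑ u, ∑ v, (x u - x v) ^ 2 = 2 * (Fintype.card V * ∑ u, x u ^ 2 - (∑ u, x u) ^ 2) := by
  have : ∀ u v, (x u - x v) ^ 2 = x u ^ 2 + x v ^ 2 - 2 * (x u * x v) := fun u v => by ring
  simp only [this, Finset.sum_sub_distrib, Finset.sum_add_distrib, ← Finset.mul_sum,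
    ← Finset.sum_mul, Finset.sum_const, Finset.card_univ, nsmul_eq_mul]
  ring

theorem one_le_dist {V : Type*} (G : SimpleGraph V) (hG : G.Connected) {u v : V}
    (h : u ≠ v) : (1 : ℝ) ≤ G.dist u v := by
  exact_mod_cast hG.pos_dist_of_ne h

theorem sub_sq_le_dist_mul {V : Type*} (G : SimpleGraph V) (hG : G.Connected) (x : V → ℝ)
    (u v : V) :
    (x u - x v) ^ 2 ≤ (G.dist u v : ℝ) * (x u - x v) ^ 2 := by
  by_cases h : u = v
  · simp [h]
  · exact le_mul_of_one_le_left (sq_nonneg _) (one_le_dist G hG h)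

variable {V : Type*} [Fintype V] [DecidableEq V] (G : SimpleGraph V)

/-- The eigenspace of the distance Laplacian, as a space of functions on the vertices. -/
noncomputable abbrev eigspace (μ : ℝ) : Submodule ℝ (V → ℝ) :=
  End.eigenspace (Matrix.toLin' (distLaplacian G)) μ

theorem mem_eigspace {μ : ℝ} {x : V → ℝ} :
    x ∈ eigspace G μ ↔ distLaplacian G *ᵥ x = μ • x := by
  rw [End.mem_eigenspace_iff, Matrix.toLin'_apply]

theorem distLaplacian_apply_of_ne {u v : V} (h : u ≠ v) :
    distLaplacian G u v = -(G.dist u v : ℝ) := by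
  simp [distLaplacian, distMatrix, Matrix.diagonal_apply_ne _ h]

theorem distLaplacian_symm (u v : V) : distLaplacian G u v = distLaplacian G v u := by
  simpa using (distLaplacian_isHermitian G).apply v u

theorem distLaplacian_mulVec (x : V → ℝ) (u : V) :
    (distLaplacian G *ᵥ x) u = ∑ v, (G.dist u v : ℝ) * (x u - x v) := by
  rw [distLaplacian, Matrix.sub_mulVec, Pi.sub_apply, Matrix.mulVec_diagonal, transmission,
    Finset.sum_mul]
  simp only [Matrix.mulVec, dotProduct, distMatrix, Matrix.of_apply, mul_sub,
    Finset.sum_sub_distrib, SimpleGraph.dist_comm]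

theorem sum_distLaplacian_row (u : V) : ∑ v, distLaplacian G u v = 0 := by
  have h := distLaplacian_mulVec G (fun _ => 1) u
  simpa [Matrix.mulVec, dotProduct] using h

/-- The distance Laplacian is self-adjoint for the pairing `∑ v, x v * y v`. -/
theorem sum_mul_mulVec_comm (x y : V → ℝ) :
    ∑ u, y u * (distLaplacian G *ᵥ x) u = ∑ u, (distLaplacian G *ᵥ y) u * x u := by
  simp only [Matrix.mulVec, dotProduct, Finset.mul_sum, Finset.sum_mul]
  rw [Finset.sum_comm]
  refine Finset.sum_congr rfl fun u _ => Finset.sum_congr rfl fun v _ => ?_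
  rw [distLaplacian_symm G v u]
  ring

theorem sum_mul_eq_zero_of_mem_eigspace {μ ν : ℝ} (hne : μ ≠ ν) {x y : V → ℝ}
    (hx : x ∈ eigspace G μ) (hy : y ∈ eigspace G ν) : ∑ u, y u * x u = 0 := by
  have h := sum_mul_mulVec_comm G x y
  rw [(mem_eigspace G).1 hx, (mem_eigspace G).1 hy] at h
  have h1 : ∑ u, y u * (μ • x) u = μ * ∑ u, y u * x u := by
    rw [Finset.mul_sum]
    exact Finset.sum_congr rfl fun u _ => by simp; ring
  have h2 : ∑ u, (ν • y) u * x u = ν * ∑ u, y u * x u := by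
    rw [Finset.mul_sum]
    exact Finset.sum_congr rfl fun u _ => by simp; ring
  rw [h1, h2] at h
  by_contra h0
  exact hne (mul_right_cancel₀ h0 h)

theorem sum_mulVec (x : V → ℝ) : ∑ u, (distLaplacian G *ᵥ x) u = 0 := by
  have h := sum_mul_mulVec_comm G x (fun _ => 1)
  have h1 : distLaplacian G *ᵥ (fun _ => (1 : ℝ)) = 0 := by
    ext u
    simp [distLaplacian_mulVec]
  simpa [h1] using h

theorem two_mul_quadForm (x : V → ℝ) :
    2 * ∑ u, x u * (distLaplacian G *ᵥ x) u
      = ∑ u, ∑ v, (G.dist u v : ℝ) * (x u - x v) ^ 2 := by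
  have h1 : ∑ u, x u * (distLaplacian G *ᵥ x) u
      = ∑ u, ∑ v, (G.dist u v : ℝ) * (x u * (x u - x v)) := by
    refine Finset.sum_congr rfl fun u _ => ?_
    rw [distLaplacian_mulVec, Finset.mul_sum]
    exact Finset.sum_congr rfl fun v _ => by ring
  have h2 : ∑ u, x u * (distLaplacian G *ᵥ x) u
      = ∑ u, ∑ v, (G.dist u v : ℝ) * (x v * (x v - x u)) := by
    rw [h1, Finset.sum_comm]
    exact Finset.sum_congr rfl fun v _ => Finset.sum_congr rfl fun u _ => by
      rw [SimpleGraph.dist_comm]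
  rw [two_mul]
  nth_rewrite 1 [h1]
  rw [h2, ← Finset.sum_add_distrib]
  refine Finset.sum_congr rfl fun u _ => ?_
  rw [← Finset.sum_add_distrib]
  exact Finset.sum_congr rfl fun v _ => by ring

theorem eq_of_mem_eigspace_zero (hG : G.Connected) {x : V → ℝ} (hx : x ∈ eigspace G 0)
    (u v : V) : x u = x v := by
  have h := two_mul_quadForm G x
  rw [(mem_eigspace G).1 hx] at h
  simp only [zero_smul, Pi.zero_apply, mul_zero, Finset.sum_const_zero] at h
  have h0 : ∀ a b, 0 ≤ (G.dist a b : ℝ) * (x a - x b) ^ 2 := fun a b => by positivity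
  have h1 := (Finset.sum_eq_zero_iff_of_nonneg
    (fun a _ => Finset.sum_nonneg fun b _ => h0 a b)).1 h.symm u (Finset.mem_univ _)
  have h2 := (Finset.sum_eq_zero_iff_of_nonneg (fun b _ => h0 u b)).1 h1 v (Finset.mem_univ _)
  by_cases huv : u = v
  · rw [huv]
  · have hd : (G.dist u v : ℝ) ≠ 0 := by
      exact_mod_cast (hG.pos_dist_of_ne huv).ne'
    have := (mul_eq_zero.1 h2).resolve_left hd
    exact sub_eq_zero.1 (by simpa using this)

theorem sum_eq_zero_of_mem_eigspace {μ : ℝ} (hμ : μ ≠ 0) {x : V → ℝ} (hx : x ∈ eigspace G μ) :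
    ∑ u, x u = 0 := by
  have h := sum_mulVec G x
  rw [(mem_eigspace G).1 hx] at h
  simp only [Pi.smul_apply, smul_eq_mul, ← Finset.mul_sum] at h
  exact (mul_eq_zero.1 h).resolve_left hμ

/-- Distances between distinct vertices are at least one, so on vectors with zero sum the quadratic
form dominates that of the complete graph, whose nonzero eigenvalue is the order. -/
theorem card_le_of_mem_eigspace (hG : G.Connected) {μ : ℝ} (hμ : μ ≠ 0) {x : V → ℝ}
    (hx : x ∈ eigspace G μ) (hx0 : x ≠ 0) : (Fintype.card V : ℝ) ≤ μ := by
  have hs := sum_eq_zero_of_mem_eigspace G hμ hx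
  have h1 := two_mul_quadForm G x
  have h2 := sum_sum_sub_sq x
  have h3 : ∑ u, ∑ v, (x u - x v) ^ 2 ≤ ∑ u, ∑ v, (G.dist u v : ℝ) * (x u - x v) ^ 2 :=
    Finset.sum_le_sum fun u _ => Finset.sum_le_sum fun v _ => sub_sq_le_dist_mul G hG x u v
  have h4 : ∑ u, x u * (distLaplacian G *ᵥ x) u = μ * ∑ u, x u ^ 2 := by
    rw [(mem_eigspace G).1 hx, Finset.mul_sum]
    exact Finset.sum_congr rfl fun u _ => by simp; ring
  have h5 : 0 < ∑ u, x u ^ 2 := by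
    obtain ⟨u, hu⟩ := Function.ne_iff.1 hx0
    exact Finset.sum_pos' (fun v _ => sq_nonneg _) ⟨u, Finset.mem_univ _, by
      have : x u ≠ 0 := hu
      positivity⟩
  rw [hs] at h2
  rw [h4] at h1
  have : (Fintype.card V : ℝ) * ∑ u, x u ^ 2 ≤ μ * ∑ u, x u ^ 2 := by linarith
  exact le_of_mul_le_mul_right this h5

/-- The eigenspace of the order: functions with zero sum that are constant on the components of the
complement. -/
theorem mem_eigspace_card_iff (hG : G.Connected) [Nonempty V] {x : V → ℝ} :
    x ∈ eigspace G (Fintype.card V) ↔ ∑ u, x u = 0 ∧ ∀ u v, Gᶜ.Adj u v → x u = x v := by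
  have hn : (Fintype.card V : ℝ) ≠ 0 := by exact_mod_cast Fintype.card_ne_zero
  constructor
  · intro hx
    have hs := sum_eq_zero_of_mem_eigspace G hn hx
    refine ⟨hs, fun u v huv => ?_⟩
    have h1 := two_mul_quadForm G x
    have h2 := sum_sum_sub_sq x
    have h4 : ∑ u, x u * (distLaplacian G *ᵥ x) u = Fintype.card V * ∑ u, x u ^ 2 := by
      rw [(mem_eigspace G).1 hx, Finset.mul_sum]
      exact Finset.sum_congr rfl fun u _ => by simp; ring
    have h3 : ∑ u, ∑ v, ((G.dist u v : ℝ) * (x u - x v) ^ 2 - (x u - x v) ^ 2) = 0 := by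
      simp only [Finset.sum_sub_distrib]
      rw [h2, ← h1, h4, hs]
      ring
    have h0 : ∀ a b, 0 ≤ (G.dist a b : ℝ) * (x a - x b) ^ 2 - (x a - x b) ^ 2 :=
      fun a b => sub_nonneg.2 (sub_sq_le_dist_mul G hG x a b)
    have h5 := (Finset.sum_eq_zero_iff_of_nonneg
      (fun a _ => Finset.sum_nonneg fun b _ => h0 a b)).1 h3 u (Finset.mem_univ _)
    have h6 := (Finset.sum_eq_zero_iff_of_nonneg (fun b _ => h0 u b)).1 h5 v (Finset.mem_univ _)
    rw [SimpleGraph.compl_adj] at huv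
    have hd : (1 : ℝ) < G.dist u v := by
      exact_mod_cast hG.one_lt_dist_of_ne_of_not_adj huv.1 huv.2
    have h7 : ((G.dist u v : ℝ) - 1) * (x u - x v) ^ 2 = 0 := by linarith
    have := (mul_eq_zero.1 h7).resolve_left (by linarith)
    exact sub_eq_zero.1 (by simpa using this)
  · rintro ⟨hs, hx⟩
    rw [mem_eigspace]
    ext u
    rw [distLaplacian_mulVec]
    have : ∀ v, (G.dist u v : ℝ) * (x u - x v) = x u - x v := fun v => by
      by_cases huv : u = v
      · simp [huv]
      by_cases ha : G.Adj u v
      · rw [SimpleGraph.dist_eq_one_iff_adj.2 ha]; simp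
      · rw [hx u v (by rw [SimpleGraph.compl_adj]; exact ⟨huv, ha⟩)]; simp
    simp [this, hs]

end Form

/-! ### Eigenvalues in order -/

section Order

variable {V : Type*} [Fintype V] [DecidableEq V] (G : SimpleGraph V)

/-- Eigenvectors for the ordered eigenvalues can be chosen pairwise orthogonal. -/
theorem exists_eigenvectors : ∃ b : Fin (Fintype.card V) → V → ℝ,
    (∀ i, b i ∈ eigspace G (eigenvalue G i)) ∧ (∀ i, b i ≠ 0) ∧
    (∀ i j, i ≠ j → ∑ v, b i v * b j v = 0) ∧ Submodule.span ℝ (Set.range b) = ⊤ := by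
  let hA := distLaplacian_isHermitian G
  let e : Fin (Fintype.card V) ≃ V := Fintype.equivOfCardEq (Fintype.card_fin _)
  let L : EuclideanSpace ℝ V ≃ₗ[ℝ] (V → ℝ) := WithLp.linearEquiv 2 ℝ (V → ℝ)
  refine ⟨fun i => L (hA.eigenvectorBasis (e i)), fun i => ?_, fun i => ?_, fun i j hij => ?_, ?_⟩
  · rw [mem_eigspace]
    have h := hA.mulVec_eigenvectorBasis (e i)
    have h2 : hA.eigenvalues (e i) = eigenvalue G i := by
      simp [Matrix.IsHermitian.eigenvalues, eigenvalue, e]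
    rw [h2] at h
    exact h
  · intro h
    have := hA.eigenvectorBasis.orthonormal.ne_zero (e i)
    exact this (L.map_eq_zero_iff.1 h)
  · have h := hA.eigenvectorBasis.orthonormal.2 (e.injective.ne hij)
    change inner ℝ (hA.eigenvectorBasis (e i)) (hA.eigenvectorBasis (e j)) = 0 at h
    rw [PiLp.inner_apply] at h
    simpa [L, mul_comm] using h
  · have h := hA.eigenvectorBasis.toBasis.span_eq
    have h2 : Set.range (fun i => L (hA.eigenvectorBasis (e i)))
        = L '' Set.range hA.eigenvectorBasis.toBasis := by
      rw [← Set.range_comp]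
      ext y
      constructor
      · rintro ⟨i, rfl⟩; exact ⟨e i, by simp⟩
      · rintro ⟨i, rfl⟩; exact ⟨e.symm i, by simp⟩
    rw [h2]
    have := Submodule.map_span (L : EuclideanSpace ℝ V →ₗ[ℝ] (V → ℝ))
      (Set.range hA.eigenvectorBasis.toBasis)
    rw [h, Submodule.map_top, LinearEquiv.range] at this
    exact this.symm

theorem exists_eigenvalue_eq {μ : ℝ} {x : V → ℝ} (hx : x ∈ eigspace G μ) (hx0 : x ≠ 0) :
    ∃ i, eigenvalue G i = μ := by
  obtain ⟨b, hb, -, -, hspan⟩ := exists_eigenvectors G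
  by_contra! hne
  -- `x` is orthogonal to every `b i`, hence to itself.
  have hort : ∀ y : V → ℝ, ∑ u, y u * x u = 0 := by
    intro y
    have hy : y ∈ Submodule.span ℝ (Set.range b) := by rw [hspan]; trivial
    induction hy using Submodule.span_induction with
    | mem y hy =>
      obtain ⟨i, rfl⟩ := hy
      exact sum_mul_eq_zero_of_mem_eigspace G (hne i).symm hx (hb i)
    | zero => simp
    | add y z _ _ hy hz => simp [add_mul, Finset.sum_add_distrib, hy, hz]
    | smul c y _ hy => simp [mul_assoc, ← Finset.mul_sum, hy]
  apply hx0
  ext u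
  simpa [Pi.single_apply] using hort (Pi.single u 1)

theorem eigenvalue_antitone : Antitone (eigenvalue G) :=
  (distLaplacian_isHermitian G).eigenvalues₀_antitone

theorem le_eigenvalue_zero {μ : ℝ} {x : V → ℝ} (hx : x ∈ eigspace G μ) (hx0 : x ≠ 0)
    (h : 0 < Fintype.card V) : μ ≤ eigenvalue G ⟨0, h⟩ := by
  obtain ⟨i, rfl⟩ := exists_eigenvalue_eq G hx hx0
  exact eigenvalue_antitone G (Fin.mk_le_of_le_val (Nat.zero_le _))

theorem eigenvalue_zero_eq {μ : ℝ} (h : 0 < Fintype.card V) (hμ : eigspace G μ ≠ ⊥)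
    (hmax : ∀ ν, ∀ x ∈ eigspace G ν, x ≠ 0 → ν ≤ μ) : eigenvalue G ⟨0, h⟩ = μ := by
  obtain ⟨x, hx, hx0⟩ := Submodule.exists_mem_ne_zero_of_ne_bot hμ
  obtain ⟨b, hb, hb0, -, -⟩ := exists_eigenvectors G
  exact le_antisymm (hmax _ _ (hb _) (hb0 _)) (le_eigenvalue_zero G hx hx0 h)

/-- The eigenvalue zero is simple and all others are at least the order, so if the order occurs at
all it is the second smallest eigenvalue. -/
theorem eigenvalue_card_sub_two (hG : G.Connected) (h2 : 2 ≤ Fintype.card V)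
    (hm : eigspace G (Fintype.card V) ≠ ⊥) :
    eigenvalue G ⟨Fintype.card V - 2, by omega⟩ = Fintype.card V := by
  obtain ⟨b, hb, hb0, hort, -⟩ := exists_eigenvectors G
  set p : Fin (Fintype.card V) := ⟨Fintype.card V - 2, by omega⟩
  set q : Fin (Fintype.card V) := ⟨Fintype.card V - 1, by omega⟩
  have hpq : p ≠ q := by simp only [p, q, ne_eq, Fin.mk.injEq]; omega
  have hlow : ∀ i, (Fintype.card V : ℝ) ≤ eigenvalue G i ∨ eigenvalue G i = 0 := fun i => by
    by_cases h : eigenvalue G i = 0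
    · exact Or.inr h
    · exact Or.inl (card_le_of_mem_eigspace G hG h (hb i) (hb0 i))
  have hcard : (0 : ℝ) < Fintype.card V := by exact_mod_cast (by omega : 0 < Fintype.card V)
  have hsimple : ∀ i j, i ≠ j → eigenvalue G i = 0 → eigenvalue G j ≠ 0 := by
    intro i j hij hi hj
    have hbi := hb i
    have hbj := hb j
    rw [hi] at hbi
    rw [hj] at hbj
    obtain ⟨u, hu⟩ := Function.ne_iff.1 (hb0 i)
    obtain ⟨v, hv⟩ := Function.ne_iff.1 (hb0 j)
    have h := hort i j hij
    have hc : ∀ w, b i w * b j w = b i u * b j v := fun w => by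
      rw [eq_of_mem_eigspace_zero G hG hbi w u, eq_of_mem_eigspace_zero G hG hbj w v]
    simp only [hc, Finset.sum_const, Finset.card_univ, nsmul_eq_mul] at h
    exact (mul_ne_zero hcard.ne' (mul_ne_zero hu hv)) h
  have hp : (Fintype.card V : ℝ) ≤ eigenvalue G p := by
    rcases hlow p with h | h
    · exact h
    · have hq := eigenvalue_antitone G (show p ≤ q by
        simp only [p, q, Fin.mk_le_mk]; omega)
      rcases hlow q with h' | h'
      · linarith
      · exact absurd h' (hsimple p q hpq h)
  refine le_antisymm ?_ hp
  obtain ⟨x, hx, hx0⟩ := Submodule.exists_mem_ne_zero_of_ne_bot hm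
  obtain ⟨i, hi⟩ := exists_eigenvalue_eq G hx hx0
  have hzero : ∃ j, eigenvalue G j = 0 := by
    have : Nonempty V := Fintype.card_pos_iff.1 (by omega)
    refine exists_eigenvalue_eq G (μ := 0) (x := fun _ => 1) ?_ ?_
    · rw [mem_eigspace]; ext u; simp [distLaplacian_mulVec]
    · exact Function.ne_iff.2 ⟨Classical.arbitrary V, by simp⟩
  obtain ⟨j, hj⟩ := hzero
  -- The index of the eigenvalue zero must be the last one.
  have hjq : j = q := by
    by_contra hne
    have h1 := eigenvalue_antitone G (show j ≤ q by
      rw [Fin.le_def]; simp only [q]; omega)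
    rcases hlow q with h' | h'
    · linarith
    · exact hsimple j q hne hj h'
  rw [← hi]
  refine eigenvalue_antitone G ?_
  have hiq : i ≠ q := by rintro rfl; rw [← hjq, hj] at hi; linarith
  rw [Fin.le_def]
  have : i.val ≠ q.val := fun h => hiq (Fin.ext h)
  simp only [p, q] at *
  omega

end Order

/-! ### Fibres of a labelling -/

section Fibres

variable {V ι : Type*} [Fintype V] [DecidableEq ι]

/-- The number of elements of the fibre of `f` over `i`. -/
def fiberCard (f : V → ι) (i : ι) : ℕ := (Finset.univ.filter fun v => f v = i).card

/-- Sums of a function over the fibres of `f`. -/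
def fiberSum (f : V → ι) : (V → ℝ) →ₗ[ℝ] (ι → ℝ) where
  toFun x i := ∑ v with f v = i, x v
  map_add' x y := by ext i; simp [Finset.sum_add_distrib]
  map_smul' c x := by ext i; simp [Finset.mul_sum]

theorem fiberSum_apply (f : V → ι) (x : V → ℝ) (i : ι) :
    fiberSum f x i = ∑ v with f v = i, x v := rfl

theorem fiberCard_pos {f : V → ι} (hf : Function.Surjective f) (i : ι) : 0 < fiberCard f i := by
  obtain ⟨v, rfl⟩ := hf i
  exact Finset.card_pos.2 ⟨v, by simp⟩

theorem fiberSum_comp (f : V → ι) (y : ι → ℝ) (i : ι) :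
    fiberSum f (fun v => y (f v)) i = fiberCard f i * y i := by
  rw [fiberSum_apply, Finset.sum_congr rfl (g := fun _ => y i)
    (fun v hv => by rw [(Finset.mem_filter.1 hv).2]), Finset.sum_const, nsmul_eq_mul]
  rfl

theorem fiberSum_mul_comp (f : V → ι) (x : V → ℝ) (y : ι → ℝ) (i : ι) :
    fiberSum f (fun v => x v * y (f v)) i = fiberSum f x i * y i := by
  rw [fiberSum_apply, fiberSum_apply, Finset.sum_mul]
  exact Finset.sum_congr rfl fun v hv => by rw [(Finset.mem_filter.1 hv).2]

theorem fiberSum_surjective {f : V → ι} (hf : Function.Surjective f) :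
    Function.Surjective (fiberSum f) := by
  intro y
  refine ⟨fun v => y (f v) / fiberCard f (f v), ?_⟩
  ext i
  have h : (fiberCard f i : ℝ) ≠ 0 := by exact_mod_cast (fiberCard_pos hf i).ne'
  rw [fiberSum_comp f (fun i => y i / fiberCard f i)]
  field_simp

variable [Fintype ι]

theorem sum_fiberSum (f : V → ι) (x : V → ℝ) : ∑ i, fiberSum f x i = ∑ v, x v :=
  Finset.sum_fiberwise _ _ _

theorem sum_fiberCard (f : V → ι) : ∑ i, fiberCard f i = Fintype.card V := by
  rw [← Finset.card_univ]
  exact (Finset.card_eq_sum_card_fiberwise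
    (fun v _ => Finset.mem_coe.2 (Finset.mem_univ (f v)))).symm

theorem finrank_ker_fiberSum {f : V → ι} (hf : Function.Surjective f) :
    finrank ℝ (LinearMap.ker (fiberSum f)) + Fintype.card ι = Fintype.card V := by
  have h := LinearMap.finrank_range_add_finrank_ker (fiberSum f)
  rw [LinearMap.range_eq_top.2 (fiberSum_surjective hf), finrank_top,
    finrank_fintype_fun_eq_card, finrank_fintype_fun_eq_card] at h
  omega

/-- Imposing one more condition, orthogonality to a nonzero vector with zero fibre sums, lowers the
dimension by one. -/
theorem finrank_ker_fiberSum_prod {f : V → ι} (hf : Function.Surjective f) {z : V → ℝ}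
    (hz : fiberSum f z = 0) (hz0 : z ≠ 0) :
    finrank ℝ (LinearMap.ker ((fiberSum f).prod (dotProductBilin ℝ ℝ z)))
      + (Fintype.card ι + 1) = Fintype.card V := by
  have h := LinearMap.finrank_range_add_finrank_ker ((fiberSum f).prod (dotProductBilin ℝ ℝ z))
  have hsurj : Function.Surjective ((fiberSum f).prod (dotProductBilin ℝ ℝ z)) := by
    rintro ⟨y, t⟩
    obtain ⟨x, hx⟩ := fiberSum_surjective hf y
    have hzz : z ⬝ᵥ z ≠ 0 := fun h0 => hz0 (dotProduct_self_eq_zero.1 h0)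
    refine ⟨x + ((t - z ⬝ᵥ x) / (z ⬝ᵥ z)) • z, ?_⟩
    refine Prod.ext ?_ ?_
    · change fiberSum f (x + ((t - z ⬝ᵥ x) / (z ⬝ᵥ z)) • z) = y
      rw [map_add, map_smul, hz, hx, smul_zero, add_zero]
    · change z ⬝ᵥ (x + ((t - z ⬝ᵥ x) / (z ⬝ᵥ z)) • z) = t
      rw [dotProduct_add, dotProduct_smul, smul_eq_mul]
      field_simp
      ring
  rw [LinearMap.range_eq_top.2 hsurj, finrank_top, finrank_prod,
    finrank_fintype_fun_eq_card, finrank_fintype_fun_eq_card, finrank_self] at h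
  omega

end Fibres

/-! ### The eigenvalue equal to the order -/

section Components

theorem adj_of_label_ne {V ι : Type*} (G : SimpleGraph V) {f : V → ι}
    (hreach : ∀ u v, Gᶜ.Reachable u v ↔ f u = f v) {u v : V}
    (h : f u ≠ f v) : G.Adj u v := by
  by_contra hadj
  exact h ((hreach u v).1 (SimpleGraph.Adj.reachable ((SimpleGraph.compl_adj ..).2
    ⟨fun h' => h (congrArg f h'), hadj⟩)))

/-- A graph that joins at least two nonempty classes has diameter at most two. -/
theorem dist_eq_two {V ι : Type*} [Fintype ι] (G : SimpleGraph V) {f : V → ι}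
    (hf : Function.Surjective f) (hι : 2 ≤ Fintype.card ι) (hG : G.Connected)
    (hadj : ∀ u v, f u ≠ f v → G.Adj u v) {u v : V} (huv : u ≠ v)
    (h : ¬ G.Adj u v) : G.dist u v = 2 := by
  have : Nontrivial ι := Fintype.one_lt_card_iff_nontrivial.1 (by omega)
  obtain ⟨i, hi⟩ := exists_ne (f u)
  obtain ⟨w, rfl⟩ := hf i
  have hfuv : f u = f v := by by_contra h'; exact h (hadj _ _ h')
  have h1 := SimpleGraph.dist_le (SimpleGraph.Walk.cons (hadj u w hi.symm)
    (SimpleGraph.Walk.cons (hadj w v (hfuv ▸ hi)) SimpleGraph.Walk.nil))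
  have h2 := hG.one_lt_dist_of_ne_of_not_adj huv h
  simp at h1
  omega

variable {V ι : Type*} [Fintype V] [DecidableEq V] [Fintype ι] (G : SimpleGraph V)

/-- If the fibres of `f` are the components of the complement, then the order is an eigenvalue of
multiplicity one less than the number of fibres. -/
theorem finrank_eigspace_card_add_one (hG : G.Connected) {f : V → ι} (hf : Function.Surjective f)
    (hreach : ∀ u v, Gᶜ.Reachable u v ↔ f u = f v) :
    finrank ℝ (eigspace G (Fintype.card V)) + 1 = Fintype.card ι := by
  have : Nonempty V := hG.nonempty
  let φ : (ι → ℝ) →ₗ[ℝ] ℝ :=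
    { toFun := fun y => ∑ v, y (f v)
      map_add' := fun x y => by simp [Finset.sum_add_distrib]
      map_smul' := fun c x => by simp [Finset.mul_sum] }
  have hφ : Function.Surjective φ := fun t => by
    refine ⟨fun _ => t / Fintype.card V, ?_⟩
    have : (Fintype.card V : ℝ) ≠ 0 := by exact_mod_cast Fintype.card_ne_zero
    simp only [φ, LinearMap.coe_mk, AddHom.coe_mk, Finset.sum_const, Finset.card_univ, nsmul_eq_mul]
    field_simp
  have hdim := LinearMap.finrank_range_add_finrank_ker φ
  rw [LinearMap.range_eq_top.2 hφ, finrank_top, finrank_self, finrank_fintype_fun_eq_card] at hdim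
  have hinj : Function.Injective (LinearMap.funLeft ℝ ℝ f) :=
    LinearMap.funLeft_injective_of_surjective ℝ ℝ f hf
  have heq : eigspace G (Fintype.card V) = (LinearMap.ker φ).map (LinearMap.funLeft ℝ ℝ f) := by
    ext x
    rw [mem_eigspace_card_iff G hG, Submodule.mem_map]
    constructor
    · rintro ⟨hs, hx⟩
      have hconst : ∀ u v, Gᶜ.Reachable u v → x u = x v := by
        intro u v h
        rw [SimpleGraph.reachable_iff_reflTransGen] at h
        induction h with
        | refl => rfl
        | tail _ hadj ih => exact ih.trans (hx _ _ hadj)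
      have hfac : ∀ v, x (Function.surjInv hf (f v)) = x v := fun v =>
        hconst _ _ ((hreach _ _).2 (Function.surjInv_eq hf (f v)))
      exact ⟨fun i => x (Function.surjInv hf i), by simpa [φ, hfac] using hs, by
        ext v; simp [LinearMap.funLeft_apply, hfac]⟩
    · rintro ⟨y, hy, rfl⟩
      refine ⟨hy, fun u v huv => ?_⟩
      rw [LinearMap.funLeft_apply, LinearMap.funLeft_apply, (hreach u v).1 huv.reachable]
  have h1 := (Submodule.equivMapOfInjective (LinearMap.funLeft ℝ ℝ f) hinj
    (LinearMap.ker φ)).finrank_eq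
  rw [← heq] at h1
  omega

end Components

/-! ### Distance Laplacians with few distinct eigenvalues -/

section Form

variable {V ι : Type*} [Fintype V] [DecidableEq V] [DecidableEq ι]

/-- The distance Laplacian is `(n + lam) I - J - lam P - z zᵀ`, where `J` is the all-ones matrix,
`P` averages over the fibres of `f`, and `z` has zero sum on each fibre. -/
structure FiberForm (G : SimpleGraph V) (f : V → ι) (lam : ℝ) (z : V → ℝ) : Prop where
  lam_pos : 0 < lam
  fiberSum_eq : fiberSum f z = 0
  entry : ∀ u v, distLaplacian G u v = (if u = v then (Fintype.card V + lam : ℝ) else 0) - 1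
    - (if f v = f u then lam / fiberCard f (f u) else 0) - z u * z v

variable {G : SimpleGraph V} {f : V → ι} {lam : ℝ} {z : V → ℝ}

namespace FiberForm

theorem mulVec (h : FiberForm G f lam z) (x : V → ℝ) (u : V) :
    (distLaplacian G *ᵥ x) u = (Fintype.card V + lam) * x u - ∑ v, x v
      - lam / fiberCard f (f u) * fiberSum f x (f u) - z u * (z ⬝ᵥ x) := by
  simp only [Matrix.mulVec, dotProduct, h.entry, sub_mul, Finset.sum_sub_distrib, ite_mul, zero_mul,
    one_mul, Finset.sum_ite_eq, Finset.mem_univ, if_true, fiberSum_apply, Finset.mul_sum,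
    Finset.sum_filter, mul_assoc, mul_ite, mul_zero]

variable [Fintype ι]

theorem mem_eigspace_iff (h : FiberForm G f lam z) (hf : Function.Surjective f) {x : V → ℝ} :
    x ∈ eigspace G (Fintype.card V + lam) ↔ fiberSum f x = 0 ∧ z ⬝ᵥ x = 0 := by
  have hlam := h.lam_pos
  have hn : (Fintype.card V : ℝ) + lam ≠ 0 := by positivity
  constructor
  · intro hx
    have hs := sum_eq_zero_of_mem_eigspace G hn hx
    rw [mem_eigspace] at hx
    have hu : ∀ u, lam / fiberCard f (f u) * fiberSum f x (f u) + z u * (z ⬝ᵥ x) = 0 := fun u => by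
      have h1 := congrFun hx u
      rw [h.mulVec, hs] at h1
      simp only [Pi.smul_apply, smul_eq_mul] at h1
      linarith
    have hS : fiberSum f x = 0 := by
      ext i
      have hc : (fiberCard f i : ℝ) ≠ 0 := by exact_mod_cast (fiberCard_pos hf i).ne'
      have h1 : fiberSum f (fun u => lam / fiberCard f (f u) * fiberSum f x (f u)
          + z u * (z ⬝ᵥ x)) i = 0 := by
        simp only [hu]
        exact congrFun (map_zero (fiberSum f)) i
      have h2 : (fun u => lam / fiberCard f (f u) * fiberSum f x (f u) + z u * (z ⬝ᵥ x))
          = (fun u => lam / fiberCard f (f u) * fiberSum f x (f u)) + (z ⬝ᵥ x) • z := by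
        ext u; simp [mul_comm]
      rw [h2, map_add, map_smul, h.fiberSum_eq, smul_zero, add_zero,
        fiberSum_comp f (fun i => lam / fiberCard f i * fiberSum f x i)] at h1
      have h3 : lam * fiberSum f x i = 0 := by
        rw [← h1]; field_simp
      exact (mul_eq_zero.1 h3).resolve_left hlam.ne'
    refine ⟨hS, ?_⟩
    by_contra hne
    have hz : z = 0 := by
      ext u
      have := hu u
      rw [hS] at this
      simpa [hne] using this
    exact hne (by rw [hz, zero_dotProduct])
  · rintro ⟨hS, hz⟩
    have hs : ∑ v, x v = 0 := by rw [← sum_fiberSum f x, hS]; simp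
    rw [mem_eigspace]
    ext u
    rw [h.mulVec, hs, hS, hz]
    simp

theorem finrank_of_eq_zero (h : FiberForm G f lam z) (hf : Function.Surjective f) (hz : z = 0) :
    finrank ℝ (eigspace G (Fintype.card V + lam)) + Fintype.card ι = Fintype.card V := by
  have heq : eigspace G (Fintype.card V + lam) = LinearMap.ker (fiberSum f) := by
    ext x
    rw [h.mem_eigspace_iff hf, LinearMap.mem_ker, hz]
    simp
  rw [heq]
  exact finrank_ker_fiberSum hf

theorem finrank_of_ne_zero (h : FiberForm G f lam z) (hf : Function.Surjective f) (hz : z ≠ 0) :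
    finrank ℝ (eigspace G (Fintype.card V + lam)) + (Fintype.card ι + 1) = Fintype.card V := by
  have heq : eigspace G (Fintype.card V + lam)
      = LinearMap.ker ((fiberSum f).prod (dotProductBilin ℝ ℝ z)) := by
    ext x
    rw [h.mem_eigspace_iff hf, LinearMap.mem_ker]
    simp
  rw [heq]
  exact finrank_ker_fiberSum_prod hf h.fiberSum_eq hz

theorem le_of_mem_eigspace (h : FiberForm G f lam z) {ν : ℝ} {x : V → ℝ}
    (hx : x ∈ eigspace G ν) (hx0 : x ≠ 0) : ν ≤ Fintype.card V + lam := by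
  have hlam := h.lam_pos
  have hxx : 0 < x ⬝ᵥ x := by
    refine lt_of_le_of_ne ?_ fun h0 => hx0 (dotProduct_self_eq_zero.1 h0.symm)
    exact Finset.sum_nonneg fun u _ => mul_self_nonneg _
  have h1 : x ⬝ᵥ (distLaplacian G *ᵥ x) = ν * (x ⬝ᵥ x) := by
    rw [(mem_eigspace G).1 hx, dotProduct_smul, smul_eq_mul]
  have h2 : x ⬝ᵥ (distLaplacian G *ᵥ x) = (Fintype.card V + lam) * (x ⬝ᵥ x) - (∑ v, x v) ^ 2
      - ∑ u, x u * (lam / fiberCard f (f u) * fiberSum f x (f u)) - (z ⬝ᵥ x) ^ 2 := by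
    have h3 : ∀ u, x u * (distLaplacian G *ᵥ x) u = (Fintype.card V + lam) * (x u * x u)
        - x u * (∑ v, x v) - x u * (lam / fiberCard f (f u) * fiberSum f x (f u))
        - (z u * x u) * (z ⬝ᵥ x) := fun u => by rw [h.mulVec]; ring
    rw [dotProduct, Finset.sum_congr rfl fun u _ => h3 u]
    simp only [Finset.sum_sub_distrib, ← Finset.mul_sum, ← Finset.sum_mul]
    simp only [dotProduct]
    ring
  have h4 : 0 ≤ ∑ u, x u * (lam / fiberCard f (f u) * fiberSum f x (f u)) := by
    rw [← sum_fiberSum f]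
    refine Finset.sum_nonneg fun i _ => ?_
    rw [fiberSum_mul_comp f x (fun i => lam / fiberCard f i * fiberSum f x i)]
    have : fiberSum f x i * (lam / fiberCard f i * fiberSum f x i)
      = lam / fiberCard f i * fiberSum f x i ^ 2 := by ring
    rw [this]
    positivity
  have h5 : ν * (x ⬝ᵥ x) ≤ (Fintype.card V + lam) * (x ⬝ᵥ x) := by
    nlinarith [sq_nonneg (∑ v, x v), sq_nonneg (z ⬝ᵥ x)]
  exact le_of_mul_le_mul_right h5 hxx

theorem eigenvalue_zero (h : FiberForm G f lam z) (hf : Function.Surjective f)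
    (hcard : Fintype.card ι + 1 < Fintype.card V) :
    eigenvalue G ⟨0, by omega⟩ = Fintype.card V + lam := by
  refine eigenvalue_zero_eq G _ (fun hbot => ?_) fun ν x hx hx0 => h.le_of_mem_eigspace hx hx0
  have h1 : finrank ℝ (eigspace G (Fintype.card V + lam)) = 0 := by rw [hbot, finrank_bot]
  by_cases hz : z = 0
  · have := h.finrank_of_eq_zero hf hz; omega
  · have := h.finrank_of_ne_zero hf hz; omega

end FiberForm

end Form

/-! ### From multiplicities to the shape of the matrix -/

theorem exists_smul_vecMulVec {V : Type*} [Fintype V] [DecidableEq V] {N : Matrix V V ℝ}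
    (hsymm : ∀ u v, N u v = N v u) (hrank : finrank ℝ (LinearMap.range (Matrix.toLin' N)) ≤ 1) :
    ∃ (c : ℝ) (x : V → ℝ), ∀ u v, N u v = c * (x u * x v) := by
  obtain ⟨⟨w, hw⟩, hspan⟩ := finrank_le_one_iff.1 hrank
  have hcol : ∀ v, ∃ a : ℝ, ∀ u, N u v = a * w u := fun v => by
    obtain ⟨a, ha⟩ := hspan ⟨Matrix.toLin' N (Pi.single v 1), LinearMap.mem_range_self _ _⟩
    refine ⟨a, fun u => ?_⟩
    have := congrFun (congrArg Subtype.val ha) u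
    simpa using this.symm
  choose a ha using hcol
  by_cases hw0 : ∀ u, w u = 0
  · exact ⟨0, w, fun u v => by rw [ha, hw0]; simp⟩
  · push Not at hw0
    obtain ⟨p, hp⟩ := hw0
    refine ⟨a p / w p, w, fun u v => ?_⟩
    have h1 : a v * w p = a p * w v := by rw [← ha, ← ha, hsymm]
    rw [ha]
    field_simp
    linear_combination w u * h1

section Recover

variable {V ι : Type*} [Fintype V] [DecidableEq V] {G : SimpleGraph V} {f : V → ι}

theorem comp_sub_mean_mem_eigspace (hG : G.Connected)
    (hreach : ∀ u v, Gᶜ.Reachable u v ↔ f u = f v) (y : ι → ℝ) :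
    (fun v => y (f v) - (∑ w, y (f w)) / Fintype.card V) ∈ eigspace G (Fintype.card V) := by
  have : Nonempty V := hG.nonempty
  have hc : (Fintype.card V : ℝ) ≠ 0 := by exact_mod_cast Fintype.card_ne_zero
  rw [mem_eigspace_card_iff G hG]
  refine ⟨?_, fun u v huv => by rw [(hreach u v).1 huv.reachable]⟩
  rw [Finset.sum_sub_distrib, Finset.sum_const, Finset.card_univ, nsmul_eq_mul]
  field_simp
  ring

theorem mulVec_comp (hG : G.Connected) (hreach : ∀ u v, Gᶜ.Reachable u v ↔ f u = f v)
    (y : ι → ℝ) (u : V) :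
    (distLaplacian G *ᵥ fun v => y (f v)) u = Fintype.card V * y (f u) - ∑ w, y (f w) := by
  have : Nonempty V := hG.nonempty
  have hc : (Fintype.card V : ℝ) ≠ 0 := by exact_mod_cast Fintype.card_ne_zero
  have h := congrFun ((mem_eigspace G).1 (comp_sub_mean_mem_eigspace hG hreach y)) u
  simp only [distLaplacian_mulVec, Pi.smul_apply, smul_eq_mul, sub_sub_sub_cancel_right] at h ⊢
  rw [h]
  field_simp

/-- If the largest eigenvalue were the order, there would be no other nonzero eigenvalue, and the
complement would have no edge. -/
theorem card_lt_eigenvalue_zero [Fintype ι] (hG : G.Connected) (hf : Function.Surjective f)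
    (hreach : ∀ u v, Gᶜ.Reachable u v ↔ f u = f v) (hcard : Fintype.card ι < Fintype.card V) :
    (Fintype.card V : ℝ) < eigenvalue G ⟨0, by omega⟩ := by
  by_contra! hle
  obtain ⟨b, hb, hb0, -, hspan⟩ := exists_eigenvectors G
  let one : V → ℝ := fun _ => 1
  have hmem : ∀ i, b i ∈ eigspace G (Fintype.card V) ⊔ Submodule.span ℝ {one} := fun i => by
    by_cases h0 : eigenvalue G i = 0
    · refine Submodule.mem_sup_right (Submodule.mem_span_singleton.2 ?_)
      have hbi := hb i
      rw [h0] at hbi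
      obtain ⟨v⟩ := hG.nonempty
      exact ⟨b i v, by ext u; simp [one, eq_of_mem_eigspace_zero G hG hbi u v]⟩
    · refine Submodule.mem_sup_left ?_
      have h1 := card_le_of_mem_eigspace G hG h0 (hb i) (hb0 i)
      have h2 := eigenvalue_antitone G
        (show (⟨0, by omega⟩ : Fin (Fintype.card V)) ≤ i from Fin.mk_le_of_le_val (Nat.zero_le _))
      have h3 : eigenvalue G i = Fintype.card V := le_antisymm (h2.trans hle) h1
      rw [← h3]
      exact hb i
  have htop : eigspace G (Fintype.card V) ⊔ Submodule.span ℝ {one} = ⊤ := by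
    rw [eq_top_iff, ← hspan, Submodule.span_le]
    rintro _ ⟨i, rfl⟩
    exact hmem i
  have h1 := Submodule.finrank_add_le_finrank_add_finrank (eigspace G (Fintype.card V))
    (Submodule.span ℝ {one})
  rw [htop, finrank_top, finrank_fintype_fun_eq_card] at h1
  have h2 : finrank ℝ (Submodule.span ℝ {one}) ≤ 1 := by
    simpa using finrank_span_le_card (R := ℝ) ({one} : Set (V → ℝ))
  have h3 := finrank_eigspace_card_add_one G hG hf hreach
  omega

variable [DecidableEq ι]

theorem fiberSum_eq_zero_of_mem_eigspace (hG : G.Connected)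
    (hreach : ∀ u v, Gᶜ.Reachable u v ↔ f u = f v) {μ : ℝ} (hμ : μ ≠ 0)
    (hμ' : μ ≠ Fintype.card V) {x : V → ℝ} (hx : x ∈ eigspace G μ) : fiberSum f x = 0 := by
  ext i
  have hs := sum_eq_zero_of_mem_eigspace G hμ hx
  have h := sum_mul_eq_zero_of_mem_eigspace G hμ' hx
    (comp_sub_mean_mem_eigspace hG hreach (Pi.single i 1))
  simp only [sub_mul, Finset.sum_sub_distrib, ← Finset.mul_sum, hs, mul_zero, sub_zero] at h
  rw [fiberSum_apply, Finset.sum_filter]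
  simpa [Pi.single_apply] using h

variable [Fintype ι]

/-- If the largest eigenvalue `n + lam` and the eigenvalues `n` and `0` account for all but at most
one dimension, then `(n + lam) I - J - lam P - D^L` vanishes on a hyperplane; being symmetric
it is a multiple of some `x xᵀ`, and the multiple is nonnegative because `n + lam` is
largest. -/
theorem exists_fiberForm (hG : G.Connected) (hf : Function.Surjective f)
    (hreach : ∀ u v, Gᶜ.Reachable u v ↔ f u = f v) (hcard : Fintype.card ι < Fintype.card V)
    (hm : Fintype.card V ≤ finrank ℝ (eigspace G (eigenvalue G ⟨0, by omega⟩))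
      + (Fintype.card ι + 1)) :
    ∃ lam z, FiberForm G f lam z := by
  have : Nonempty V := hG.nonempty
  have hlt := card_lt_eigenvalue_zero hG hf hreach hcard
  have hc : (0 : ℝ) < Fintype.card V := by exact_mod_cast Fintype.card_pos
  obtain ⟨lam, hlam⟩ : ∃ lam, eigenvalue G ⟨0, by omega⟩ = Fintype.card V + lam :=
    ⟨_, (add_sub_cancel _ _).symm⟩
  rw [hlam] at hlt hm
  have hpos : 0 < lam := by linarith
  have hFpos : ∀ i, (fiberCard f i : ℝ) ≠ 0 := fun i => by exact_mod_cast (fiberCard_pos hf i).ne'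
  -- `N` collects what is missing from `z = 0`; it has rank at most one.
  let N : Matrix V V ℝ := Matrix.of fun u v => (if u = v then (Fintype.card V + lam : ℝ) else 0) - 1
    - (if f v = f u then lam / fiberCard f (f u) else 0) - distLaplacian G u v
  have hN : ∀ x u, (N *ᵥ x) u = (Fintype.card V + lam) * x u - ∑ v, x v
      - lam / fiberCard f (f u) * fiberSum f x (f u) - (distLaplacian G *ᵥ x) u := fun x u => by
    simp only [N, Matrix.mulVec, dotProduct, Matrix.of_apply, sub_mul, Finset.sum_sub_distrib,
      ite_mul, zero_mul, one_mul, Finset.sum_ite_eq, Finset.mem_univ, if_true, fiberSum_apply,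
      Finset.mul_sum, Finset.sum_filter, mul_ite, mul_zero]
  have hNsymm : ∀ u v, N u v = N v u := fun u v => by
    simp only [N, Matrix.of_apply, distLaplacian_symm G u v, eq_comm (a := u) (b := v)]
    by_cases h : f u = f v
    · simp [h]
    · simp [h, Ne.symm h]
  have hNcomp : ∀ y : ι → ℝ, N *ᵥ (fun v => y (f v)) = 0 := fun y => by
    ext u
    have := hFpos (f u)
    rw [hN, mulVec_comp hG hreach, fiberSum_comp]
    simp only [Pi.zero_apply]
    field_simp
    ring
  have hNE : ∀ x ∈ eigspace G (Fintype.card V + lam), fiberSum f x = 0 ∧ N *ᵥ x = 0 :=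
    fun x hx => by
      have hS := fiberSum_eq_zero_of_mem_eigspace hG hreach (by linarith) (by linarith) hx
      refine ⟨hS, ?_⟩
      have hs : ∑ v, x v = 0 := by rw [← sum_fiberSum f x, hS]; simp
      ext u
      rw [hN, hs, hS, (mem_eigspace G).1 hx]
      simp
  have hrank : finrank ℝ (LinearMap.range (Matrix.toLin' N)) ≤ 1 := by
    let F : Submodule ℝ (V → ℝ) := LinearMap.range (LinearMap.funLeft ℝ ℝ f)
    have hF : finrank ℝ F = Fintype.card ι := by
      rw [LinearMap.finrank_range_of_inj (LinearMap.funLeft_injective_of_surjective ℝ ℝ f hf),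
        finrank_fintype_fun_eq_card]
    have hinf : eigspace G (Fintype.card V + lam) ⊓ F = ⊥ := by
      rw [eq_bot_iff]
      rintro _ ⟨hx, y, rfl⟩
      have h := (hNE _ hx).1
      have hy : y = 0 := by
        ext i
        have h1 := congrFun h i
        have h2 : fiberSum f (LinearMap.funLeft ℝ ℝ f y) i = fiberCard f i * y i :=
          fiberSum_comp f y i
        rw [h2] at h1
        exact (mul_eq_zero.1 h1).resolve_left (hFpos i)
      simp [hy]
    have hle : eigspace G (Fintype.card V + lam) ⊔ F ≤ LinearMap.ker (Matrix.toLin' N) := by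
      refine sup_le (fun x hx => ?_) ?_
      · rw [LinearMap.mem_ker, Matrix.toLin'_apply]
        exact (hNE x hx).2
      · rintro _ ⟨y, rfl⟩
        rw [LinearMap.mem_ker, Matrix.toLin'_apply]
        exact hNcomp y
    have h1 := Submodule.finrank_sup_add_finrank_inf_eq (eigspace G (Fintype.card V + lam)) F
    rw [hinf, finrank_bot, hF] at h1
    have h2 := Submodule.finrank_mono hle
    have h3 := LinearMap.finrank_range_add_finrank_ker (Matrix.toLin' N)
    rw [finrank_fintype_fun_eq_card] at h3
    omega
  obtain ⟨c, x, hcx⟩ := exists_smul_vecMulVec hNsymm hrank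
  have hentry : ∀ u v, distLaplacian G u v = (if u = v then (Fintype.card V + lam : ℝ) else 0) - 1
      - (if f v = f u then lam / fiberCard f (f u) else 0) - c * (x u * x v) := fun u v => by
    rw [← hcx]
    simp [N]
  by_cases hzero : c = 0 ∨ x = 0
  · refine ⟨lam, 0, hpos, map_zero _, fun u v => ?_⟩
    rw [hentry]
    rcases hzero with h | h <;> simp [h]
  push Not at hzero
  obtain ⟨hc0, hx0⟩ := hzero
  have hSx : fiberSum f x = 0 := by
    ext i
    obtain ⟨p, hp⟩ := Function.ne_iff.1 hx0
    have h := congrFun (hNcomp (Pi.single i 1)) p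
    have h' : c * x p * fiberSum f x i = 0 := by
      refine Eq.trans ?_ h
      rw [fiberSum_apply, Finset.sum_filter, Finset.mul_sum]
      simp only [Matrix.mulVec, dotProduct, hcx, Pi.single_apply]
      exact Finset.sum_congr rfl fun v _ => by split_ifs <;> ring
    exact (mul_eq_zero.1 h').resolve_left (mul_ne_zero hc0 hp)
  have hxx : 0 < x ⬝ᵥ x := by
    refine lt_of_le_of_ne ?_ fun h0 => hx0 (dotProduct_self_eq_zero.1 h0.symm)
    exact Finset.sum_nonneg fun u _ => mul_self_nonneg _
  have hxeig : x ∈ eigspace G (Fintype.card V + lam - c * (x ⬝ᵥ x)) := by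
    rw [mem_eigspace]
    ext u
    have hs : ∑ v, x v = 0 := by rw [← sum_fiberSum f x, hSx]; simp
    have h1 := hN x u
    have h2 : (N *ᵥ x) u = c * x u * (x ⬝ᵥ x) := by
      simp only [Matrix.mulVec, dotProduct, hcx, Finset.mul_sum]
      exact Finset.sum_congr rfl fun v _ => by ring
    rw [h2, hs, hSx] at h1
    simp only [Pi.zero_apply, Pi.smul_apply, smul_eq_mul] at h1 ⊢
    linarith
  -- Otherwise `x` would belong to an eigenvalue larger than the largest one.
  have hcnn : 0 ≤ c := by
    have h := le_eigenvalue_zero G hxeig hx0 (by omega)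
    rw [hlam] at h
    by_contra! hneg
    nlinarith
  refine ⟨lam, √c • x, hpos, by rw [map_smul, hSx, smul_zero], fun u v => ?_⟩
  rw [hentry]
  simp only [Pi.smul_apply, smul_eq_mul]
  have := Real.mul_self_sqrt hcnn
  linear_combination (x u * x v) * this

end Recover

/-! ### The structure of the classes -/

section Structure

variable {V ι : Type*} [Fintype V] [DecidableEq V] [DecidableEq ι]
  {G : SimpleGraph V} {f : V → ι} {lam : ℝ} {z : V → ℝ}

namespace FiberForm

theorem mul_eq_zero_of_label_ne (h : FiberForm G f lam z) (hadj : ∀ u v, f u ≠ f v → G.Adj u v)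
    {u v : V} (huv : f u ≠ f v) : z u * z v = 0 := by
  have h1 := h.entry u v
  have hne : u ≠ v := fun h' => huv (congrArg f h')
  rw [distLaplacian_apply_of_ne G hne, SimpleGraph.dist_eq_one_iff_adj.2 (hadj u v huv), if_neg hne,
    if_neg (Ne.symm huv)] at h1
  push_cast at h1
  linarith

theorem mul_eq_of_adj (h : FiberForm G f lam z) {u v : V} (huv : f u = f v) (ha : G.Adj u v) :
    z u * z v = -(lam / fiberCard f (f u)) := by
  have h1 := h.entry u v
  rw [distLaplacian_apply_of_ne G ha.ne, SimpleGraph.dist_eq_one_iff_adj.2 ha, if_neg ha.ne,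
    if_pos huv.symm] at h1
  push_cast at h1
  linarith

theorem exists_mul_neg (h : FiberForm G f lam z) {u : V} (hu : z u ≠ 0) :
    ∃ v, f v = f u ∧ z u * z v < 0 := by
  by_contra! hcon
  have h1 : ∑ v with f v = f u, z u * z v = 0 := by
    rw [← Finset.mul_sum, ← fiberSum_apply, h.fiberSum_eq]
    simp
  have h2 := (Finset.sum_eq_zero_iff_of_nonneg
    (fun v hv => hcon v (Finset.mem_filter.1 hv).2)).1 h1 u (by simp)
  exact hu (mul_self_eq_zero.1 h2)

variable [Fintype ι]

theorem mul_eq_of_not_adj (h : FiberForm G f lam z) (hf : Function.Surjective f)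
    (hι : 2 ≤ Fintype.card ι) (hG : G.Connected) (hadj : ∀ u v, f u ≠ f v → G.Adj u v)
    {u v : V} (hne : u ≠ v) (huv : f u = f v) (ha : ¬ G.Adj u v) :
    z u * z v = 1 - lam / fiberCard f (f u) := by
  have h1 := h.entry u v
  rw [distLaplacian_apply_of_ne G hne, dist_eq_two G hf hι hG hadj hne ha, if_neg hne,
    if_pos huv.symm] at h1
  push_cast at h1
  linarith

end FiberForm

theorem exists_adj_of_reachable {V : Type*} {H : SimpleGraph V} {a b : V} (h : H.Reachable a b)
    (hne : a ≠ b) : ∃ w, H.Adj a w := by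
  rw [SimpleGraph.reachable_iff_reflTransGen] at h
  rcases h.cases_head with h | ⟨w, hw, -⟩
  · exact absurd h hne
  · exact ⟨w, hw⟩

theorem not_three_mul_neg {a b c : ℝ} (hab : a * b < 0) (hac : a * c < 0) (hbc : b * c < 0) :
    False := by
  have h1 : 0 < (a * b) * (a * c) := mul_pos_of_neg_of_neg hab hac
  have h2 : (a * b) * (a * c) * (b * c) < 0 := mul_neg_of_pos_of_neg h1 hbc
  have h3 : (a * b) * (a * c) * (b * c) = (a * b * c) ^ 2 := by ring
  nlinarith [sq_nonneg (a * b * c)]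

variable [Fintype ι]

namespace FiberForm

/-- A class larger than `lam` cannot exist: in it, adjacency in the complement would mean having
`z`-values of the same sign, so by connectedness all signs would agree, while `z` sums to zero. -/
theorem fiberCard_le (h : FiberForm G f lam z) (hf : Function.Surjective f)
    (hι : 2 ≤ Fintype.card ι) (hG : G.Connected) (hreach : ∀ u v, Gᶜ.Reachable u v ↔ f u = f v)
    {i : ι} (hi : 2 ≤ fiberCard f i) : (fiberCard f i : ℝ) ≤ lam := by
  by_contra! hlt
  have hadj : ∀ u v, f u ≠ f v → G.Adj u v := fun u v => adj_of_label_ne G hreach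
  have hlam := h.lam_pos
  have hq : lam / fiberCard f i < 1 := (div_lt_one (by linarith)).2 hlt
  have hpos : ∀ u v, f u = i → Gᶜ.Adj u v → 0 < z u * z v := fun u v hu huv => by
    have h1 := (SimpleGraph.compl_adj ..).1 huv
    rw [h.mul_eq_of_not_adj hf hι hG hadj h1.1 ((hreach u v).1 huv.reachable) h1.2, hu]
    linarith
  obtain ⟨a, ha, b, hb, hab⟩ := Finset.one_lt_card.1 hi
  simp only [Finset.mem_filter, Finset.mem_univ, true_and] at ha hb
  obtain ⟨w, hw⟩ := exists_adj_of_reachable ((hreach a b).2 (ha.trans hb.symm)) hab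
  have ha0 : z a ≠ 0 := fun h0 => by
    have := hpos a w ha hw
    rw [h0, zero_mul] at this
    exact lt_irrefl _ this
  obtain ⟨v, hv, hneg⟩ := h.exists_mul_neg ha0
  have hall : ∀ v, Gᶜ.Reachable a v → 0 < z a * z v := by
    intro v hv
    have hv' := hv
    rw [SimpleGraph.reachable_iff_reflTransGen] at hv'
    induction hv' with
    | refl => exact mul_self_pos.2 ha0
    | @tail y w hay hyw ih =>
      have hay' : Gᶜ.Reachable a y := by rwa [SimpleGraph.reachable_iff_reflTransGen]
      have h1 := ih hay'
      have h2 := hpos y w (((hreach a y).1 hay').symm.trans ha) hyw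
      have h3 := mul_pos h1 h2
      have h4 : z a * z y * (z y * z w) = z a * z w * (z y) ^ 2 := by ring
      rw [h4] at h3
      exact pos_of_mul_pos_left h3 (sq_nonneg _)
  exact absurd (hall v ((hreach a v).2 hv.symm)) (not_lt.2 hneg.le)

/-- A class smaller than `lam` has pairwise negative products of `z`-values, hence at most two
elements. -/
theorem fiberCard_le_two (h : FiberForm G f lam z) (hf : Function.Surjective f)
    (hι : 2 ≤ Fintype.card ι) (hG : G.Connected) (hadj : ∀ u v, f u ≠ f v → G.Adj u v)
    {i : ι} (hi : (fiberCard f i : ℝ) < lam) : fiberCard f i ≤ 2 := by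
  by_contra! hlt
  have hlam := h.lam_pos
  obtain ⟨a, b, c, ha, hb, hc, hab, hac, hbc⟩ := Finset.two_lt_card_iff.1 hlt
  simp only [Finset.mem_filter, Finset.mem_univ, true_and] at ha hb hc
  have hc0 : (0 : ℝ) < fiberCard f i := by exact_mod_cast (by omega : 0 < fiberCard f i)
  have hq : 1 < lam / fiberCard f i := (one_lt_div hc0).2 hi
  have hneg : ∀ u v, f u = i → f v = i → u ≠ v → z u * z v < 0 := fun u v hu hv huv => by
    by_cases hA : G.Adj u v
    · rw [h.mul_eq_of_adj (hu.trans hv.symm) hA, hu]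
      linarith
    · rw [h.mul_eq_of_not_adj hf hι hG hadj huv (hu.trans hv.symm) hA, hu]
      linarith
  exact not_three_mul_neg (hneg a b ha hb hab) (hneg a c ha hc hac) (hneg b c hb hc hbc)

end FiberForm

/-- The possible shapes of a class of a graph in fibre form. The class is independent and `z`
vanishes on it, and its order is `1` or `lam`; or it is independent of order `2 < lam`; or it has
order `lam` and carries exactly one edge. In the last two cases `z` does not vanish on it. -/
theorem FiberForm.fiber_cases (h : FiberForm G f lam z) (hf : Function.Surjective f)
    (hι : 2 ≤ Fintype.card ι) (hG : G.Connected) (hreach : ∀ u v, Gᶜ.Reachable u v ↔ f u = f v)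
    (i : ι) :
    ((∀ u v, f u = i → f v = i → ¬ G.Adj u v) ∧ (∀ u, f u = i → z u = 0) ∧
      (fiberCard f i = 1 ∨ (fiberCard f i : ℝ) = lam)) ∨
    ((∃ u, f u = i ∧ z u ≠ 0) ∧ (∀ u v, f u = i → f v = i → ¬ G.Adj u v) ∧
      fiberCard f i = 2 ∧ 2 < lam) ∨
    ((∃ u, f u = i ∧ z u ≠ 0) ∧ (fiberCard f i : ℝ) = lam ∧ 3 ≤ fiberCard f i ∧
      ∃ a b, a ≠ b ∧ f a = i ∧ f b = i ∧ ∀ u v, f u = i → f v = i →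
        (G.Adj u v ↔ (u = a ∧ v = b) ∨ (u = b ∧ v = a))) := by
  have hadj : ∀ u v, f u ≠ f v → G.Adj u v := fun u v => adj_of_label_ne G hreach
  have hpos := fiberCard_pos hf i
  have hlam := h.lam_pos
  rcases Nat.lt_or_ge (fiberCard f i) 2 with h1 | h2
  · have h1' : fiberCard f i = 1 := by omega
    have huniq : ∀ u v, f u = i → f v = i → u = v := fun u v hu hv =>
      Finset.card_le_one.1 h1'.le u (by simp [hu]) v (by simp [hv])
    refine Or.inl ⟨fun u v hu hv hA => hA.ne (huniq u v hu hv), fun u hu => ?_, Or.inl h1'⟩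
    by_contra hu0
    obtain ⟨v, hv, hneg⟩ := h.exists_mul_neg hu0
    rw [huniq v u (hv.trans hu) hu] at hneg
    exact absurd (mul_self_nonneg (z u)) (not_le.2 hneg)
  · rcases (h.fiberCard_le hf hι hG hreach h2).lt_or_eq with hlt | heq
    · have hle := h.fiberCard_le_two hf hι hG hadj hlt
      have h2' : fiberCard f i = 2 := by omega
      have hind : ∀ u v, f u = i → f v = i → ¬ G.Adj u v := by
        intro u v hu hv hA
        obtain ⟨w, hw⟩ := exists_adj_of_reachable ((hreach u v).2 (hu.trans hv.symm)) hA.ne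
        have hfw : f w = i := ((hreach u w).1 hw.reachable).symm.trans hu
        have hw' := (SimpleGraph.compl_adj ..).1 hw
        have hwv : w ≠ v := fun h' => hw'.2 (h' ▸ hA)
        exact absurd (Finset.two_lt_card_iff.2 ⟨u, v, w, by simp [hu], by simp [hv], by simp [hfw],
          hA.ne, hw'.1, hwv.symm⟩) (not_lt.2 hle)
      refine Or.inr (Or.inl ⟨?_, hind, h2', by rw [h2'] at hlt; exact_mod_cast hlt⟩)
      obtain ⟨a, ha, b, hb, hab⟩ := Finset.one_lt_card.1 h2
      simp only [Finset.mem_filter, Finset.mem_univ, true_and] at ha hb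
      refine ⟨a, ha, fun h0 => ?_⟩
      have hm := h.mul_eq_of_not_adj hf hι hG hadj hab (ha.trans hb.symm) (hind a b ha hb)
      have hc0 : (0 : ℝ) < fiberCard f i := by exact_mod_cast hpos
      have hq : 1 < lam / fiberCard f i := (one_lt_div hc0).2 hlt
      rw [h0, ha] at hm
      linarith
    · have hq : lam / fiberCard f i = 1 := by rw [heq, div_self hlam.ne']
      have hA : ∀ u v, f u = i → f v = i → G.Adj u v → z u * z v = -1 := fun u v hu hv hA => by
        rw [h.mul_eq_of_adj (hu.trans hv.symm) hA, hu, hq]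
      have hB : ∀ u v, f u = i → f v = i → u ≠ v → ¬ G.Adj u v → z u * z v = 0 :=
        fun u v hu hv huv hA => by
          rw [h.mul_eq_of_not_adj hf hι hG hadj huv (hu.trans hv.symm) hA, hu, hq, sub_self]
      by_cases hz : ∀ u, f u = i → z u = 0
      · refine Or.inl ⟨fun u v hu hv huv => ?_, hz, Or.inr heq⟩
        have := hA u v hu hv huv
        rw [hz u hu] at this
        norm_num at this
      · push Not at hz
        obtain ⟨a, ha, ha0⟩ := hz
        obtain ⟨b, hb, hneg⟩ := h.exists_mul_neg ha0
        have hb' := hb.trans ha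
        have hab : a ≠ b := fun h' => by
          rw [← h'] at hneg
          exact absurd (mul_self_nonneg (z a)) (not_le.2 hneg)
        have hAab : G.Adj a b := by
          by_contra hcon
          exact absurd (hB a b ha hb' hab hcon) hneg.ne
        have hb0 : z b ≠ 0 := fun h0 => by rw [h0, mul_zero] at hneg; exact lt_irrefl _ hneg
        -- A third nonzero value would give three pairwise negative products.
        have hother : ∀ w, f w = i → z w ≠ 0 → w = a ∨ w = b := by
          intro w hw hw0
          by_contra! hcon
          have hneg' : ∀ u, f u = i → z u ≠ 0 → u ≠ w → z u * z w < 0 := fun u hu hu0 huw => by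
            by_cases hG' : G.Adj u w
            · rw [hA u w hu hw hG']; norm_num
            · exact absurd (hB u w hu hw huw hG') (mul_ne_zero hu0 hw0)
          exact not_three_mul_neg hneg (hneg' a ha ha0 hcon.1.symm) (hneg' b hb' hb0 hcon.2.symm)
        obtain ⟨w, hw⟩ := exists_adj_of_reachable ((hreach a b).2 hb.symm) hab
        have hw' := (SimpleGraph.compl_adj ..).1 hw
        have hfw : f w = i := ((hreach a w).1 hw.reachable).symm.trans ha
        refine Or.inr (Or.inr ⟨⟨a, ha, ha0⟩, heq, ?_, a, b, hab, ha, hb', fun u v hu hv => ?_⟩)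
        · exact Finset.two_lt_card_iff.2 ⟨a, b, w, by simp [ha], by simp [hb'], by simp [hfw],
            hab, hw'.1, fun h' => hw'.2 (h' ▸ hAab)⟩
        · constructor
          · intro huv
            have h1 := hA u v hu hv huv
            have hu0 : z u ≠ 0 := fun h0 => by rw [h0] at h1; norm_num at h1
            have hv0 : z v ≠ 0 := fun h0 => by rw [h0] at h1; norm_num at h1
            have hne := huv.ne
            rcases hother u hu hu0 with rfl | rfl <;> rcases hother v hv hv0 with rfl | rfl <;>
              simp_all
          · rintro (⟨rfl, rfl⟩ | ⟨rfl, rfl⟩)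
            · exact hAab
            · exact hAab.symm

end Structure

/-! ### From the structure of the classes to the shape of the matrix -/

section Converse

variable {V ι : Type*} [DecidableEq V] [DecidableEq ι]
  {G : SimpleGraph V} {f : V → ι} {lam : ℝ} {z : V → ℝ}

theorem reachable_compl_iff {V ι : Type*} {G : SimpleGraph V} {f : V → ι}
    (hadj : ∀ u v, f u ≠ f v → G.Adj u v)
    (h : ∀ u v, u ≠ v → f u = f v → Gᶜ.Reachable u v) (u v : V) :
    Gᶜ.Reachable u v ↔ f u = f v := by
  constructor
  · intro huv
    rw [SimpleGraph.reachable_iff_reflTransGen] at huv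
    induction huv with
    | refl => rfl
    | @tail y w _ hyw ih =>
      refine ih.trans ?_
      by_contra hne
      exact ((SimpleGraph.compl_adj ..).1 hyw).2 (hadj _ _ hne)
  · intro huv
    by_cases hne : u = v
    · rw [hne]
    · exact h u v hne huv

/-- A class of order `1` or `s` with two distinct elements has order `s`. -/
theorem fiberCard_eq_of_ne {V ι : Type*} [Fintype V] [DecidableEq ι] {f : V → ι}
    {s : ℕ} {u v : V} (huv : u ≠ v) (hfuv : f u = f v)
    (h : fiberCard f (f u) = 1 ∨ fiberCard f (f u) = s) : fiberCard f (f u) = s := by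
  refine h.resolve_left fun h1 => huv ?_
  exact Finset.card_le_one.1 h1.le u (by simp) v (by simp [hfuv])

/-- The vector with value `r` at `a`, `-r` at `b`, and `0` elsewhere. -/
def pairVec (a b : V) (r : ℝ) : V → ℝ := r • (Pi.single a 1 - Pi.single b 1)

theorem pairVec_of_ne {a b v : V} (r : ℝ) (ha : v ≠ a) (hb : v ≠ b) : pairVec a b r v = 0 := by
  simp [pairVec, ha, hb]

theorem pairVec_mul {a b : V} (r : ℝ) (hab : a ≠ b) :
    pairVec a b r a * pairVec a b r b = -(r * r) := by
  simp [pairVec, hab, hab.symm]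

variable [Fintype V]

theorem fiberSum_pairVec {a b : V} (r : ℝ) (hab : f a = f b) : fiberSum f (pairVec a b r) = 0 := by
  have h : ∀ c : V, fiberSum f (Pi.single c 1) = Pi.single (f c) 1 := fun c => by
    ext i
    rw [fiberSum_apply, Finset.sum_pi_single']
    simp [Pi.single_apply, eq_comm]
  rw [pairVec, map_smul, map_sub, h, h, hab, sub_self, smul_zero]

variable [Fintype ι]

/-- Only off-diagonal entries need to be checked: both sides have zero row sums. -/
theorem FiberForm.of_adj (hf : Function.Surjective f) (hι : 2 ≤ Fintype.card ι)
    (hG : G.Connected) (hadj : ∀ u v, f u ≠ f v → G.Adj u v) (hlam : 0 < lam)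
    (hz : fiberSum f z = 0) (hne : ∀ u v, f u ≠ f v → z u * z v = 0)
    (hA : ∀ u v, f u = f v → G.Adj u v → z u * z v = -(lam / fiberCard f (f u)))
    (hB : ∀ u v, u ≠ v → f u = f v → ¬ G.Adj u v → z u * z v = 1 - lam / fiberCard f (f u)) :
    FiberForm G f lam z := by
  have hoff : ∀ u v, u ≠ v → distLaplacian G u v
      = (if u = v then (Fintype.card V + lam : ℝ) else 0) - 1
        - (if f v = f u then lam / fiberCard f (f u) else 0) - z u * z v := by
    intro u v huv
    rw [distLaplacian_apply_of_ne G huv, if_neg huv]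
    by_cases hfuv : f u = f v
    · rw [if_pos hfuv.symm]
      by_cases ha : G.Adj u v
      · rw [hA u v hfuv ha, SimpleGraph.dist_eq_one_iff_adj.2 ha]
        push_cast; ring
      · rw [hB u v huv hfuv ha, dist_eq_two G hf hι hG hadj huv ha]
        push_cast; ring
    · rw [if_neg (Ne.symm hfuv), hne u v hfuv, SimpleGraph.dist_eq_one_iff_adj.2 (hadj u v hfuv)]
      push_cast; ring
  refine ⟨hlam, hz, fun u v => ?_⟩
  by_cases huv : u = v
  swap
  · exact hoff u v huv
  subst huv
  have hrow : ∑ v, ((if u = v then (Fintype.card V + lam : ℝ) else 0) - 1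
        - (if f v = f u then lam / fiberCard f (f u) else 0) - z u * z v) = 0 := by
    have hs : ∑ v, z v = 0 := by rw [← sum_fiberSum f z, hz]; simp
    have hc : (fiberCard f (f u) : ℝ) ≠ 0 := by exact_mod_cast (fiberCard_pos hf (f u)).ne'
    have hS : ∑ v, (if f v = f u then lam / fiberCard f (f u) else 0) = lam := by
      rw [← Finset.sum_filter, Finset.sum_const, nsmul_eq_mul]
      change (fiberCard f (f u) : ℝ) * _ = _
      field_simp
    rw [Finset.sum_sub_distrib, Finset.sum_sub_distrib, Finset.sum_sub_distrib, hS,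
      ← Finset.mul_sum, hs]
    simp
  have h0 := sum_distLaplacian_row G u
  rw [← Finset.add_sum_erase _ _ (Finset.mem_univ u)] at h0 hrow
  rw [Finset.sum_congr rfl fun v hv => hoff u v (Finset.ne_of_mem_erase hv).symm] at h0
  linarith

/-- Complete multipartite graphs whose parts have order `1` or `s`. -/
theorem fiberForm_zero (hf : Function.Surjective f) (hι : 2 ≤ Fintype.card ι) (hG : G.Connected)
    (hadj : ∀ u v, G.Adj u v ↔ f u ≠ f v) {s : ℕ} (hs : 0 < s)
    (hcard : ∀ i, fiberCard f i = 1 ∨ fiberCard f i = s) : FiberForm G f s 0 := by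
  have hs' : (0 : ℝ) < s := by exact_mod_cast hs
  refine FiberForm.of_adj hf hι hG (fun u v => (hadj u v).2) hs' (map_zero _) (by simp)
    (fun u v huv hA => absurd huv ((hadj u v).1 hA)) fun u v huv hfuv _ => ?_
  rw [fiberCard_eq_of_ne huv hfuv (hcard _), div_self hs'.ne']
  simp

/-- Complete multipartite graphs with one part of order `2` and all others of order `1` or `s`. -/
theorem fiberForm_of_pair (hf : Function.Surjective f) (hι : 2 ≤ Fintype.card ι)
    (hG : G.Connected) (hadj : ∀ u v, G.Adj u v ↔ f u ≠ f v) {s : ℕ} (hs : 2 < s) {i₀ : ι}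
    (hi₀ : fiberCard f i₀ = 2)
    (hcard : ∀ i, i ≠ i₀ → fiberCard f i = 1 ∨ fiberCard f i = s) :
    ∃ z, z ≠ 0 ∧ FiberForm G f s z := by
  have hs' : (2 : ℝ) < s := by exact_mod_cast hs
  obtain ⟨a, b, hab, hfil⟩ := Finset.card_eq_two.1 hi₀
  have hmem : ∀ v, f v = i₀ ↔ v = a ∨ v = b := fun v => by
    have := Finset.ext_iff.1 hfil v
    simpa using this
  have ha : f a = i₀ := (hmem a).2 (Or.inl rfl)
  have hb : f b = i₀ := (hmem b).2 (Or.inr rfl)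
  -- The only product to be matched is `1 - s / 2`, for the two elements of the pair.
  have hr : √((s : ℝ) / 2 - 1) * √((s : ℝ) / 2 - 1) = s / 2 - 1 :=
    Real.mul_self_sqrt (by linarith)
  have hprod := pairVec_mul √((s : ℝ) / 2 - 1) hab
  have hvan : ∀ v, f v ≠ i₀ → pairVec a b √((s : ℝ) / 2 - 1) v = 0 := fun v hv =>
    pairVec_of_ne _ (fun h => hv (h ▸ ha)) (fun h => hv (h ▸ hb))
  refine ⟨pairVec a b √((s : ℝ) / 2 - 1), fun h0 => ?_, FiberForm.of_adj hf hι hG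
    (fun u v => (hadj u v).2) (by linarith) (fiberSum_pairVec _ (ha.trans hb.symm))
    (fun u v huv => ?_) (fun u v huv hA => absurd huv ((hadj u v).1 hA)) fun u v huv hfuv _ => ?_⟩
  · rw [h0] at hprod
    simp only [Pi.zero_apply, mul_zero] at hprod
    linarith
  · by_cases hu : f u = i₀
    · rw [hvan v fun hv => huv (hu.trans hv.symm), mul_zero]
    · rw [hvan u hu, zero_mul]
  · by_cases hu : f u = i₀
    · rw [hu, hi₀]
      rcases (hmem u).1 hu with rfl | rfl <;> rcases (hmem v).1 (hfuv ▸ hu) with rfl | rfl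
      · exact absurd rfl huv
      · rw [hprod, hr]; push_cast; ring
      · rw [mul_comm, hprod, hr]; push_cast; ring
      · exact absurd rfl huv
    · rw [hvan u hu, fiberCard_eq_of_ne huv hfuv (hcard _ hu), div_self (by linarith)]
      ring

/-- Complete multipartite graphs whose parts have order `1` or `s`, with one edge added. -/
theorem fiberForm_of_edge (hf : Function.Surjective f) (hι : 2 ≤ Fintype.card ι)
    (hG : G.Connected) {a b : V} (hab : a ≠ b) (hfab : f a = f b)
    (hadj : ∀ u v, G.Adj u v ↔ f u ≠ f v ∨ (u = a ∧ v = b) ∨ (u = b ∧ v = a))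
    {s : ℕ} (hs : 0 < s) (hcard : ∀ i, fiberCard f i = 1 ∨ fiberCard f i = s) :
    ∃ z, z ≠ 0 ∧ FiberForm G f s z := by
  have hs' : (0 : ℝ) < s := by exact_mod_cast hs
  have hprod := pairVec_mul 1 hab
  refine ⟨pairVec a b 1, fun h0 => ?_, FiberForm.of_adj hf hι hG
    (fun u v h => (hadj u v).2 (Or.inl h)) hs' (fiberSum_pairVec _ hfab)
    (fun u v huv => ?_) (fun u v huv hA => ?_) fun u v huv hfuv hA => ?_⟩
  · rw [h0] at hprod
    norm_num at hprod
  · by_cases hu : u = a ∨ u = b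
    · have hfu : f u = f a := by
        rcases hu with rfl | rfl
        exacts [rfl, hfab.symm]
      rw [pairVec_of_ne (v := v) 1 (fun h => huv (h ▸ hfu)) (fun h => huv (by rw [h, ← hfab, hfu])),
        mul_zero]
    · push Not at hu
      rw [pairVec_of_ne 1 hu.1 hu.2, zero_mul]
  · rw [fiberCard_eq_of_ne hA.ne huv (hcard _), div_self hs'.ne']
    rcases (hadj u v).1 hA with h | ⟨rfl, rfl⟩ | ⟨rfl, rfl⟩
    · exact absurd huv h
    · rw [hprod]; norm_num
    · rw [mul_comm, hprod]; norm_num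
  · rw [fiberCard_eq_of_ne huv hfuv (hcard _), div_self hs'.ne', sub_self]
    rw [hadj] at hA
    push Not at hA
    by_cases hu : u ≠ a ∧ u ≠ b
    · rw [pairVec_of_ne 1 hu.1 hu.2, zero_mul]
    · have hv : v ≠ a ∧ v ≠ b := by
        by_contra hv
        have hu' : u = a ∨ u = b := by tauto
        have hv' : v = a ∨ v = b := by tauto
        rcases hu' with h | h <;> rcases hv' with h' | h'
        exacts [huv (h.trans h'.symm), hA.2.1 h h', hA.2.2 h h', huv (h.trans h'.symm)]
      rw [pairVec_of_ne 1 hv.1 hv.2, mul_zero]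

end Converse

/-! ### Complete multipartite graphs with prescribed part sizes -/

section Parts

/-- `X` is complete multipartite with parts, labelled by `Fin k`, of orders `t 0, …, t (k - 1)`. -/
def HasParts {W : Type*} (X : SimpleGraph W) {k : ℕ} (t : Fin k → ℕ) : Prop :=
  ∃ g : W → Fin k, (∀ u v, X.Adj u v ↔ g u ≠ g v) ∧ ∀ i, Nat.card {w // g w = i} = t i

/-- `X` is complete multipartite with parts of orders `t 0, …, t (k - 1)`, except for one additional
edge inside the part with label `i₀`. -/
def HasPartsAddEdge {W : Type*} (X : SimpleGraph W) {k : ℕ} (t : Fin k → ℕ) (i₀ : Fin k) : Prop :=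
  ∃ (g : W → Fin k) (a b : W), a ≠ b ∧ g a = i₀ ∧ g b = i₀ ∧
    (∀ u v, X.Adj u v ↔ g u ≠ g v ∨ (u = a ∧ v = b) ∨ (u = b ∧ v = a)) ∧
    ∀ i, Nat.card {w // g w = i} = t i

variable {V W : Type*} {G : SimpleGraph V} {X : SimpleGraph W} {k : ℕ} {t : Fin k → ℕ}

theorem natCard_fiber_comp_equiv (e : V ≃ W) (g : W → Fin k) (i : Fin k) :
    Nat.card {v // g (e v) = i} = Nat.card {w // g w = i} :=
  Nat.card_congr (e.subtypeEquiv fun _ => Iff.rfl)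

theorem natCard_fiber_perm (g : W → Fin k) (σ : Equiv.Perm (Fin k)) (i : Fin k) :
    Nat.card {w // σ.symm (g w) = i} = Nat.card {w // g w = σ i} :=
  Nat.card_congr (Equiv.subtypeEquivRight fun _ => Equiv.symm_apply_eq σ)

theorem HasParts.perm (h : HasParts X t) (σ : Equiv.Perm (Fin k)) : HasParts X (t ∘ σ) := by
  obtain ⟨g, hadj, hcard⟩ := h
  refine ⟨fun w => σ.symm (g w), fun u v => ?_, fun i => ?_⟩
  · rw [hadj, ne_eq, ne_eq, σ.symm.injective.eq_iff]
  · rw [natCard_fiber_perm, hcard, Function.comp_apply]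

theorem HasPartsAddEdge.perm {i₀ : Fin k} (h : HasPartsAddEdge X t i₀)
    (σ : Equiv.Perm (Fin k)) : HasPartsAddEdge X (t ∘ σ) (σ.symm i₀) := by
  obtain ⟨g, a, b, hab, ha, hb, hadj, hcard⟩ := h
  refine ⟨fun w => σ.symm (g w), a, b, hab, congrArg σ.symm ha,
    congrArg σ.symm hb, fun u v => ?_, fun i => ?_⟩
  · rw [hadj, ne_eq, ne_eq, σ.symm.injective.eq_iff]
  · rw [natCard_fiber_perm, hcard, Function.comp_apply]

/-- The parts can be listed in nonincreasing order. -/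
theorem exists_perm_antitone (t : Fin k → ℕ) : ∃ σ : Equiv.Perm (Fin k), Antitone (t ∘ σ) :=
  ⟨Fin.revPerm.trans (Tuple.sort t), fun _ _ h => Tuple.monotone_sort t (Fin.rev_le_rev.2 h)⟩

theorem exists_equiv_comp_eq [Finite V] [Finite W] {f : V → Fin k} {g : W → Fin k}
    (h : ∀ i, Nat.card {v // f v = i} = Nat.card {w // g w = i}) :
    ∃ e : V ≃ W, ∀ v, g (e v) = f v := by
  let E : ∀ i, {v // f v = i} ≃ {w // g w = i} := fun i => (Finite.card_eq.1 (h i)).some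
  refine ⟨(Equiv.sigmaFiberEquiv f).symm.trans ((Equiv.sigmaCongrRight E).trans
    (Equiv.sigmaFiberEquiv g)), fun v => ?_⟩
  exact (E (f v) ⟨v, rfl⟩).2

theorem nonempty_iso_iff [Finite V] [Finite W] (hX : HasParts X t) :
    Nonempty (G ≃g X) ↔ HasParts G t := by
  obtain ⟨g, hadj, hcard⟩ := hX
  constructor
  · rintro ⟨e⟩
    exact ⟨fun v => g (e v), fun u v => by rw [← hadj, e.map_adj_iff], fun i =>
      (natCard_fiber_comp_equiv e.toEquiv g i).trans (hcard i)⟩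
  · rintro ⟨f, hadj', hcard'⟩
    obtain ⟨e, he⟩ := exists_equiv_comp_eq (f := f) (g := g) fun i => by rw [hcard, hcard']
    exact ⟨⟨e, fun {u v} => by rw [hadj, hadj', he, he]⟩⟩

theorem isIsoAddEdge_iff [Finite V] [Finite W] (hX : HasParts X t) :
    IsIsoAddEdge G X ↔ ∃ i₀, HasPartsAddEdge G t i₀ := by
  obtain ⟨g, hadj, hcard⟩ := hX
  constructor
  · rintro ⟨a, b, hab, hnadj, ⟨e⟩⟩
    have hgab : g a = g b := by
      by_contra h
      exact hnadj ((hadj a b).2 h)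
    refine ⟨g a, fun v => g (e v), e.symm a, e.symm b, e.symm.injective.ne hab,
      congrArg g (e.apply_symm_apply a), (congrArg g (e.apply_symm_apply b)).trans hgab.symm,
      fun u v => ?_,
      fun i => (natCard_fiber_comp_equiv e.toEquiv g i).trans (hcard i)⟩
    rw [← e.map_adj_iff, SimpleGraph.sup_adj, SimpleGraph.edge_adj, hadj]
    have hsymm : ∀ (x : V) (y : W), x = e.symm y ↔ e x = y := fun x y =>
      e.toEquiv.eq_symm_apply
    simp only [hsymm]
    constructor
    · rintro (h | ⟨h, -⟩)
      exacts [Or.inl h, Or.inr h]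
    · rintro (h | ⟨h1, h2⟩ | ⟨h1, h2⟩)
      · exact Or.inl h
      · exact Or.inr ⟨Or.inl ⟨h1, h2⟩, by rw [h1, h2]; exact hab⟩
      · exact Or.inr ⟨Or.inr ⟨h1, h2⟩, by rw [h1, h2]; exact hab.symm⟩
  · rintro ⟨i₀, f, a, b, hab, ha, hb, hadj', hcard'⟩
    obtain ⟨e, he⟩ := exists_equiv_comp_eq (f := f) (g := g) fun i => by rw [hcard, hcard']
    refine ⟨e a, e b, e.injective.ne hab, ?_, ⟨⟨e, fun {u v} => ?_⟩⟩⟩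
    · rw [hadj, he, he, ha, hb]
      simp
    · rw [SimpleGraph.sup_adj, SimpleGraph.edge_adj, hadj, hadj', he, he]
      simp only [e.injective.eq_iff, ne_eq]
      constructor
      · rintro (h | ⟨h, -⟩)
        exacts [Or.inl h, Or.inr h]
      · rintro (h | ⟨rfl, rfl⟩ | ⟨rfl, rfl⟩)
        · exact Or.inl h
        · exact Or.inr ⟨Or.inl ⟨rfl, rfl⟩, hab⟩
        · exact Or.inr ⟨Or.inr ⟨rfl, rfl⟩, hab.symm⟩

theorem hasParts_completeMultipartite (t : Fin k → ℕ) : HasParts (completeMultipartite t) t :=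
  ⟨Sigma.fst, fun _ _ => Iff.rfl, fun i => by
    rw [Nat.card_congr (Equiv.sigmaSubtype i), Nat.card_eq_fintype_card, Fintype.card_fin]⟩

theorem natCard_subtype_sum {A B : Type*} [Finite A] [Finite B] (p : A ⊕ B → Prop) :
    Nat.card {w // p w} = Nat.card {a // p (Sum.inl a)} + Nat.card {b // p (Sum.inr b)} := by
  rw [Nat.card_congr Equiv.subtypeSum, Nat.card_sum]

theorem hasParts_completeSplit {n α : ℕ} (h : n - α = k) :
    HasParts (completeSplit n α) (Fin.cons α fun _ : Fin k => 1 : Fin (k + 1) → ℕ) := by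
  subst h
  refine ⟨Sum.elim (fun _ => 0) Fin.succ, ?_, fun i => ?_⟩
  · rintro (u | u) (v | v) <;> simp [completeSplit, (Fin.succ_ne_zero _).symm]
  · rw [natCard_subtype_sum]
    refine Fin.cases ?_ (fun j => ?_) i
    · simp [Fin.succ_ne_zero]
    · simp [(Fin.succ_ne_zero _).symm]

theorem hasParts_complThreeCliques (a b c : ℕ) :
    HasParts (complThreeCliques a b c) ![a, b, c] := by
  refine ⟨Sum.elim (Sum.elim (fun _ => 0) fun _ => 1) fun _ => 2, ?_, fun i => ?_⟩
  · rintro ((u | u) | u) ((v | v) | v) <;> simp [complThreeCliques]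
  · rw [natCard_subtype_sum, natCard_subtype_sum]
    fin_cases i <;> simp

variable [Fintype V]

theorem natCard_fiber (f : V → Fin k) (i : Fin k) :
    Nat.card {v // f v = i} = fiberCard f i := by
  rw [Nat.card_eq_fintype_card, Fintype.card_subtype, fiberCard]

theorem HasParts.sum_eq (h : HasParts G t) : ∑ i, t i = Fintype.card V := by
  obtain ⟨g, -, hcard⟩ := h
  simp only [natCard_fiber] at hcard
  rw [← sum_fiberCard g]
  exact Finset.sum_congr rfl fun i _ => (hcard i).symm

theorem HasPartsAddEdge.sum_eq {i₀ : Fin k} (h : HasPartsAddEdge G t i₀) :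
    ∑ i, t i = Fintype.card V := by
  obtain ⟨g, -, -, -, -, -, -, hcard⟩ := h
  simp only [natCard_fiber] at hcard
  rw [← sum_fiberCard g]
  exact Finset.sum_congr rfl fun i _ => (hcard i).symm

theorem HasPartsAddEdge.two_le {i₀ : Fin k} (h : HasPartsAddEdge G t i₀) : 2 ≤ t i₀ := by
  obtain ⟨g, a, b, hab, ha, hb, -, hcard⟩ := h
  rw [← hcard, natCard_fiber]
  exact Finset.one_lt_card.2 ⟨a, by simp [ha], b, by simp [hb], hab⟩

end Parts

/-! ### Multiplicities and parts -/

section Main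

variable {V : Type*} [Fintype V] [DecidableEq V] {G : SimpleGraph V}

theorem exists_label (hG : G.Connected) {k : ℕ}
    (h : finrank ℝ (eigspace G (Fintype.card V)) + 1 = k) :
    ∃ f : V → Fin k, Function.Surjective f ∧ ∀ u v, Gᶜ.Reachable u v ↔ f u = f v := by
  have : Fintype Gᶜ.ConnectedComponent := Fintype.ofFinite _
  have hsurj : Function.Surjective Gᶜ.connectedComponentMk := Quot.mk_surjective
  have hc := finrank_eigspace_card_add_one G hG hsurj
    fun u v => SimpleGraph.ConnectedComponent.eq.symm
  let e : Gᶜ.ConnectedComponent ≃ Fin k := Fintype.equivFinOfCardEq (hc.symm.trans h)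
  exact ⟨fun v => e (Gᶜ.connectedComponentMk v), e.surjective.comp hsurj, fun u v => by
    rw [e.injective.eq_iff, SimpleGraph.ConnectedComponent.eq]⟩

theorem surjective_of_fiberCard {V ι : Type*} [Fintype V] [DecidableEq ι] {f : V → ι}
    (h : ∀ i, fiberCard f i ≠ 0) : Function.Surjective f := fun i => by
  obtain ⟨v, hv⟩ := Finset.card_ne_zero.1 (h i)
  exact ⟨v, by simpa using hv⟩

theorem multiplicity_three_iff (hG : G.Connected) (hn : 6 ≤ Fintype.card V) :
    (finrank ℝ (eigspace G (eigenvalue G ⟨0, by omega⟩)) + 4 = Fintype.card V ∧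
      finrank ℝ (eigspace G (Fintype.card V)) = 3) ↔
    ∃ t : Fin 4 → ℕ, HasParts G t ∧ ∃ s, 2 ≤ s ∧ ∀ i, t i = 1 ∨ t i = s := by
  constructor
  · rintro ⟨h1, h3⟩
    obtain ⟨f, hf, hreach⟩ := exists_label hG (k := 4) (by omega)
    have hcard : Fintype.card (Fin 4) = 4 := Fintype.card_fin 4
    obtain ⟨lam, z, h⟩ := exists_fiberForm hG hf hreach (by omega) (by omega)
    rw [h.eigenvalue_zero hf (by omega)] at h1
    have hz : z = 0 := by
      by_contra hz
      have := h.finrank_of_ne_zero hf hz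
      omega
    have hcase : ∀ i, (∀ u v, f u = i → f v = i → ¬ G.Adj u v) ∧
        (fiberCard f i = 1 ∨ (fiberCard f i : ℝ) = lam) := fun i => by
      rcases h.fiber_cases hf (by omega) hG hreach i with h | h | h
      · exact ⟨h.1, h.2.2⟩
      · obtain ⟨⟨u, -, hu⟩, -⟩ := h
        exact absurd (congrFun hz u) hu
      · obtain ⟨⟨u, -, hu⟩, -⟩ := h
        exact absurd (congrFun hz u) hu
    have hlarge : ∃ i, fiberCard f i ≠ 1 := by
      by_contra! hcon
      have := sum_fiberCard f
      simp only [hcon, Finset.sum_const, Finset.card_univ, hcard, smul_eq_mul] at this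
      omega
    obtain ⟨j, hj⟩ := hlarge
    have hjl := (hcase j).2.resolve_left hj
    refine ⟨fiberCard f, ⟨f, fun u v => ⟨fun hA huv => ?_, adj_of_label_ne G hreach⟩,
      natCard_fiber f⟩, fiberCard f j, ?_, fun i => ?_⟩
    · exact (hcase (f v)).1 u v huv rfl hA
    · have := fiberCard_pos hf j
      omega
    · refine (hcase i).2.imp_right fun hi => ?_
      exact_mod_cast hi.trans hjl.symm
  · rintro ⟨t, ⟨f, hadj, hcard⟩, s, hs, ht⟩
    simp only [natCard_fiber] at hcard
    have hf : Function.Surjective f := surjective_of_fiberCard fun i => by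
      rw [hcard]; rcases ht i with h | h <;> omega
    have hι : Fintype.card (Fin 4) = 4 := Fintype.card_fin 4
    have hreach := reachable_compl_iff (fun u v => (hadj u v).2) fun u v hne huv =>
      SimpleGraph.Adj.reachable ((SimpleGraph.compl_adj ..).2 ⟨hne, fun hA => (hadj u v).1 hA huv⟩)
    have h := fiberForm_zero hf (by omega) hG hadj (s := s) (by omega) fun i => hcard i ▸ ht i
    have hm := finrank_eigspace_card_add_one G hG hf hreach
    have hd := h.finrank_of_eq_zero hf rfl
    rw [h.eigenvalue_zero hf (by omega)]
    omega

theorem multiplicity_two_iff (hG : G.Connected) (hn : 6 ≤ Fintype.card V) :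
    (finrank ℝ (eigspace G (eigenvalue G ⟨0, by omega⟩)) + 4 = Fintype.card V ∧
      finrank ℝ (eigspace G (Fintype.card V)) = 2) ↔
    (∃ t : Fin 3 → ℕ, HasParts G t ∧ ∃ s i₀, 3 ≤ s ∧ t i₀ = 2 ∧
      ∀ i, i ≠ i₀ → t i = 1 ∨ t i = s) ∨
    (∃ (t : Fin 3 → ℕ) (i₀ : Fin 3), HasPartsAddEdge G t i₀ ∧ 3 ≤ t i₀ ∧
      ∀ i, t i = 1 ∨ t i = t i₀) := by
  have hι : Fintype.card (Fin 3) = 3 := Fintype.card_fin 3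
  -- A form with nonzero `z` has the required multiplicities.
  have hback : ∀ {f : V → Fin 3} {s : ℕ}, Function.Surjective f →
      (∀ u v, Gᶜ.Reachable u v ↔ f u = f v) → (∃ z, z ≠ 0 ∧ FiberForm G f s z) →
      (finrank ℝ (eigspace G (eigenvalue G ⟨0, by omega⟩)) + 4 = Fintype.card V ∧
      finrank ℝ (eigspace G (Fintype.card V)) = 2) := by
    rintro f s hf hreach ⟨z, hz, h⟩
    have hm := finrank_eigspace_card_add_one G hG hf hreach
    have hd := h.finrank_of_ne_zero hf hz
    rw [h.eigenvalue_zero hf (by omega)]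
    omega
  constructor
  · rintro ⟨h1, h2⟩
    obtain ⟨f, hf, hreach⟩ := exists_label hG (k := 3) (by omega)
    have hadj : ∀ u v, f u ≠ f v → G.Adj u v := fun u v => adj_of_label_ne G hreach
    obtain ⟨lam, z, h⟩ := exists_fiberForm hG hf hreach (by omega) (by omega)
    rw [h.eigenvalue_zero hf (by omega)] at h1
    have hz : z ≠ 0 := fun hz => by
      have := h.finrank_of_eq_zero hf hz
      omega
    obtain ⟨p, hp⟩ := Function.ne_iff.1 hz
    have hother : ∀ i, i ≠ f p → (∀ u v, f u = i → f v = i → ¬ G.Adj u v) ∧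
        (fiberCard f i = 1 ∨ (fiberCard f i : ℝ) = lam) := fun i hi => by
      have hzero : ∀ u, f u = i → z u = 0 := fun u hu =>
        (mul_eq_zero.1 (h.mul_eq_zero_of_label_ne hadj (u := p) (v := u)
          (fun h' => hi (hu.symm.trans h'.symm)))).resolve_left hp
      rcases h.fiber_cases hf (by omega) hG hreach i with h | h | h
      · exact ⟨h.1, h.2.2⟩
      · obtain ⟨⟨u, hu, hu0⟩, -⟩ := h
        exact absurd (hzero u hu) hu0
      · obtain ⟨⟨u, hu, hu0⟩, -⟩ := h
        exact absurd (hzero u hu) hu0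
    rcases h.fiber_cases hf (by omega) hG hreach (f p) with h | ⟨-, hind, h2, hlam⟩ |
      ⟨-, hlam, h3, a, b, hab, ha, hb, hedge⟩
    · exact absurd (h.2.1 p rfl) hp
    · left
      have hlarge : ∃ i, i ≠ f p ∧ fiberCard f i ≠ 1 := by
        by_contra! hcon
        have := sum_fiberCard f
        rw [← Finset.add_sum_erase _ _ (Finset.mem_univ (f p)), h2,
          Finset.sum_congr rfl fun i hi => hcon i (Finset.ne_of_mem_erase hi), Finset.sum_const,
          Finset.card_erase_of_mem (Finset.mem_univ _), Finset.card_univ, hι] at this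
        simp only [smul_eq_mul] at this
        omega
      obtain ⟨j, hjp, hj⟩ := hlarge
      have hjl := (hother j hjp).2.resolve_left hj
      refine ⟨fiberCard f, ⟨f, fun u v => ⟨fun hA huv => ?_, hadj u v⟩, natCard_fiber f⟩,
        fiberCard f j, f p, ?_, h2, fun i hi => ?_⟩
      · by_cases hvp : f v = f p
        · exact hind u v (huv.trans hvp) hvp hA
        · exact (hother (f v) hvp).1 u v huv rfl hA
      · rw [← hjl] at hlam
        exact_mod_cast hlam
      · exact (hother i hi).2.imp_right fun hi => by exact_mod_cast hi.trans hjl.symm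
    · right
      refine ⟨fiberCard f, f p, ⟨f, a, b, hab, ha, hb, fun u v => ?_, natCard_fiber f⟩, h3,
        fun i => ?_⟩
      · by_cases huv : f u = f v
        · simp only [huv, ne_eq, not_true, false_or]
          by_cases hvp : f v = f p
          · exact hedge u v (huv.trans hvp) hvp
          · refine iff_of_false ((hother (f v) hvp).1 u v huv rfl) ?_
            rintro (⟨-, rfl⟩ | ⟨-, rfl⟩)
            exacts [hvp hb, hvp ha]
        · exact iff_of_true (hadj u v huv) (Or.inl huv)
      · by_cases hi : i = f p
        · rw [hi]; exact Or.inr rfl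
        · exact (hother i hi).2.imp_right fun hi => by exact_mod_cast hi.trans hlam.symm
  · rintro (⟨t, ⟨f, hadj, hcard⟩, s, i₀, hs, hi₀, ht⟩ |
      ⟨t, i₀, ⟨f, a, b, hab, ha, hb, hadj, hcard⟩, h3, ht⟩)
    · simp only [natCard_fiber] at hcard
      have hf : Function.Surjective f := surjective_of_fiberCard fun i => by
        rw [hcard]
        by_cases hi : i = i₀
        · rw [hi]; omega
        · rcases ht i hi with h | h <;> omega
      have hreach := reachable_compl_iff (fun u v => (hadj u v).2) fun u v hne huv =>
        SimpleGraph.Adj.reachable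
          ((SimpleGraph.compl_adj ..).2 ⟨hne, fun hA => (hadj u v).1 hA huv⟩)
      exact hback hf hreach (fiberForm_of_pair hf (by omega) hG hadj (s := s) (by omega)
        ((hcard i₀).trans hi₀) fun i hi => hcard i ▸ ht i hi)
    · simp only [natCard_fiber] at hcard
      have hf : Function.Surjective f := surjective_of_fiberCard fun i => by
        rw [hcard]
        rcases ht i with h | h <;> omega
      have hcompl : ∀ u v, u ≠ v → f u = f v → ¬ ((u = a ∧ v = b) ∨ (u = b ∧ v = a)) →
          Gᶜ.Reachable u v := fun u v hne huv hex =>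
        SimpleGraph.Adj.reachable ((SimpleGraph.compl_adj ..).2 ⟨hne, fun hA => by
          rcases (hadj u v).1 hA with h | h
          exacts [h huv, hex h]⟩)
      -- The ends of the added edge are joined in the complement through a third vertex.
      have hreach_ab : Gᶜ.Reachable a b := by
        have h3' : 2 < fiberCard f i₀ := by rw [hcard]; omega
        obtain ⟨w, hw, hwn⟩ := Finset.exists_mem_notMem_of_card_lt_card
          (lt_of_le_of_lt (Finset.card_le_two (a := a) (b := b)) h3')
        simp only [Finset.mem_filter, Finset.mem_univ, true_and, Finset.mem_insert,
          Finset.mem_singleton, not_or] at hw hwn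
        refine (hcompl a w (Ne.symm hwn.1) (ha.trans hw.symm) ?_).trans
          (hcompl w b hwn.2 (hw.trans hb.symm) ?_)
        · rintro (⟨-, h⟩ | ⟨h, -⟩)
          exacts [hwn.2 h, hab h]
        · rintro (⟨h, -⟩ | ⟨h, -⟩)
          exacts [hwn.1 h, hwn.2 h]
      have hreach := reachable_compl_iff (fun u v h => (hadj u v).2 (Or.inl h))
          fun u v hne huv => by
        by_cases hex : (u = a ∧ v = b) ∨ (u = b ∧ v = a)
        · rcases hex with ⟨rfl, rfl⟩ | ⟨rfl, rfl⟩
          exacts [hreach_ab, hreach_ab.symm]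
        · exact hcompl u v hne huv hex
      exact hback hf hreach (fiberForm_of_edge hf (by omega) hG hab (ha.trans hb.symm) hadj
        (s := t i₀) (by omega) fun i => hcard i ▸ ht i)

end Main

/-! ### The lists of graphs -/

section Lists

variable {V : Type*} [Fintype V] {G : SimpleGraph V}

/-- The possible part orders of a complete multipartite graph with four parts, each of order `1` or
a common `s ≥ 2`. -/
theorem hasParts_four_iff {n : ℕ} (hcard : Fintype.card V = n) (hn : 6 ≤ n) :
    (∃ t : Fin 4 → ℕ, HasParts G t ∧ ∃ s, 2 ≤ s ∧ ∀ i, t i = 1 ∨ t i = s) ↔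
    ((n ≡ 0 [MOD 4] ∧ HasParts G ![n / 4, n / 4, n / 4, n / 4]) ∨
      (n ≡ 1 [MOD 3] ∧ HasParts G ![(n - 1) / 3, (n - 1) / 3, (n - 1) / 3, 1]) ∨
      (n ≡ 2 [MOD 2] ∧ HasParts G ![(n - 2) / 2, (n - 2) / 2, 1, 1]) ∨
      HasParts G ![n - 3, 1, 1, 1]) := by
  simp only [Nat.ModEq]
  constructor
  · rintro ⟨t', hparts', s, hs, ht'⟩
    obtain ⟨σ, hσ⟩ := exists_perm_antitone t'
    have hparts := hparts'.perm σ
    have ht : ∀ i, (t' ∘ σ) i = 1 ∨ (t' ∘ σ) i = s := fun i => ht' (σ i)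
    generalize t' ∘ σ = t at hσ hparts ht
    have hsum := hparts.sum_eq
    rw [hcard, Fin.sum_univ_four] at hsum
    have h01 : t 1 ≤ t 0 := hσ (by decide)
    have h12 : t 2 ≤ t 1 := hσ (by decide)
    have h23 : t 3 ≤ t 2 := hσ (by decide)
    have e : t = ![t 0, t 1, t 2, t 3] := by ext i; fin_cases i <;> rfl
    rw [e] at hparts
    have key : (n % 4 = 0 ∧ t 0 = n / 4 ∧ t 1 = n / 4 ∧ t 2 = n / 4 ∧ t 3 = n / 4) ∨
        (n % 3 = 1 ∧ t 0 = (n - 1) / 3 ∧ t 1 = (n - 1) / 3 ∧ t 2 = (n - 1) / 3 ∧ t 3 = 1) ∨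
        (n % 2 = 0 ∧ t 0 = (n - 2) / 2 ∧ t 1 = (n - 2) / 2 ∧ t 2 = 1 ∧ t 3 = 1) ∨
        (t 0 = n - 3 ∧ t 1 = 1 ∧ t 2 = 1 ∧ t 3 = 1) := by
      have h0 := ht 0
      have h1 := ht 1
      clear e
      rcases ht 3 with h3 | h3
      · rcases ht 2 with h2 | h2
        · rcases h1 with h1 | h1
          · exact Or.inr (Or.inr (Or.inr (by omega)))
          · exact Or.inr (Or.inr (Or.inl (by omega)))
        · exact Or.inr (Or.inl (by omega))
      · exact Or.inl (by omega)
    rcases key with ⟨h, h0, h1, h2, h3⟩ | ⟨h, h0, h1, h2, h3⟩ | ⟨h, h0, h1, h2, h3⟩ |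
      ⟨h0, h1, h2, h3⟩ <;> rw [h0, h1, h2, h3] at hparts
    · exact Or.inl ⟨h, hparts⟩
    · exact Or.inr (Or.inl ⟨h, hparts⟩)
    · exact Or.inr (Or.inr (Or.inl ⟨h, hparts⟩))
    · exact Or.inr (Or.inr (Or.inr hparts))
  · rintro (⟨h, hp⟩ | ⟨h, hp⟩ | ⟨h, hp⟩ | hp)
    · exact ⟨_, hp, n / 4, by omega, fun i => by fin_cases i <;> simp⟩
    · exact ⟨_, hp, (n - 1) / 3, by omega, fun i => by fin_cases i <;> simp⟩
    · exact ⟨_, hp, (n - 2) / 2, by omega, fun i => by fin_cases i <;> simp⟩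
    · exact ⟨_, hp, n - 3, by omega, fun i => by fin_cases i <;> simp⟩

theorem hasParts_three_iff {n : ℕ} (hcard : Fintype.card V = n) (hn : 6 ≤ n) :
    (∃ t : Fin 3 → ℕ, HasParts G t ∧ ∃ s i₀, 3 ≤ s ∧ t i₀ = 2 ∧
      ∀ i, i ≠ i₀ → t i = 1 ∨ t i = s) ↔
    (HasParts G ![n - 3, 2, 1] ∨ ∃ p, 3 ≤ p ∧ n = 2 * p + 2 ∧ HasParts G ![p, p, 2]) := by
  constructor
  · rintro ⟨t', hparts', s, i₀', hs, hi₀', ht'⟩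
    obtain ⟨σ, hσ⟩ := exists_perm_antitone t'
    have hparts := hparts'.perm σ
    obtain ⟨i₀, rfl⟩ := σ.surjective i₀'
    have hi₀ : (t' ∘ σ) i₀ = 2 := hi₀'
    have ht : ∀ i, i ≠ i₀ → (t' ∘ σ) i = 1 ∨ (t' ∘ σ) i = s := fun i hi =>
      ht' (σ i) (σ.injective.ne hi)
    generalize t' ∘ σ = t at hσ hparts ht hi₀
    have hsum := hparts.sum_eq
    rw [hcard, Fin.sum_univ_three] at hsum
    have h01 : t 1 ≤ t 0 := hσ (by decide)
    have h12 : t 2 ≤ t 1 := hσ (by decide)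
    have e : t = ![t 0, t 1, t 2] := by ext i; fin_cases i <;> rfl
    rw [e] at hparts
    have key : (t 0 = n - 3 ∧ t 1 = 2 ∧ t 2 = 1) ∨
        (t 0 = s ∧ t 1 = s ∧ t 2 = 2 ∧ n = 2 * s + 2) := by
      have h0 : i₀ ≠ 0 → t 0 = 1 ∨ t 0 = s := fun h => ht 0 h.symm
      have h1 : i₀ ≠ 1 → t 1 = 1 ∨ t 1 = s := fun h => ht 1 h.symm
      have h2 : i₀ ≠ 2 → t 2 = 1 ∨ t 2 = s := fun h => ht 2 h.symm
      clear ht e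
      fin_cases i₀ <;> simp at h0 h1 h2 hi₀ <;> omega
    rcases key with ⟨h0, h1, h2⟩ | ⟨h0, h1, h2, h3⟩ <;> rw [h0, h1, h2] at hparts
    · exact Or.inl hparts
    · exact Or.inr ⟨s, hs, h3, hparts⟩
  · rintro (hp | ⟨p, hp3, rfl, hp⟩)
    · exact ⟨_, hp, n - 3, 1, by omega, rfl, fun i hi => by fin_cases i <;> simp at hi ⊢⟩
    · exact ⟨_, hp, p, 2, hp3, rfl, fun i hi => by fin_cases i <;> simp at hi ⊢⟩

theorem hasPartsAddEdge_three_iff {n : ℕ} (hcard : Fintype.card V = n) (hn : 6 ≤ n) :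
    (∃ (t : Fin 3 → ℕ) (i₀ : Fin 3), HasPartsAddEdge G t i₀ ∧ 3 ≤ t i₀ ∧
      ∀ i, t i = 1 ∨ t i = t i₀) ↔
    ((∃ i₀, HasPartsAddEdge G ![n - 2, 1, 1] i₀) ∨
      (∃ p, 3 ≤ p ∧ n = 2 * p + 1 ∧ ∃ i₀, HasPartsAddEdge G ![p, p, 1] i₀) ∨
      (∃ p, 3 ≤ p ∧ n = 3 * p ∧ ∃ i₀, HasPartsAddEdge G ![p, p, p] i₀)) := by
  constructor
  · rintro ⟨t', i₀', hparts', h3', ht'⟩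
    obtain ⟨σ, hσ⟩ := exists_perm_antitone t'
    have hparts := hparts'.perm σ
    obtain ⟨i₀, rfl⟩ := σ.surjective i₀'
    rw [Equiv.symm_apply_apply] at hparts
    have h3 : 3 ≤ (t' ∘ σ) i₀ := h3'
    have ht : ∀ i, (t' ∘ σ) i = 1 ∨ (t' ∘ σ) i = (t' ∘ σ) i₀ := fun i => ht' (σ i)
    generalize t' ∘ σ = t at hσ hparts ht h3
    have hsum := hparts.sum_eq
    rw [hcard, Fin.sum_univ_three] at hsum
    have h01 : t 1 ≤ t 0 := hσ (by decide)
    have h12 : t 2 ≤ t 1 := hσ (by decide)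
    have h0 : t i₀ ≤ t 0 := hσ (Fin.zero_le i₀)
    have e : t = ![t 0, t 1, t 2] := by ext i; fin_cases i <;> rfl
    rw [e] at hparts
    have key : (t 0 = n - 2 ∧ t 1 = 1 ∧ t 2 = 1) ∨
        (t 0 = t i₀ ∧ t 1 = t i₀ ∧ t 2 = 1 ∧ n = 2 * t i₀ + 1) ∨
        (t 0 = t i₀ ∧ t 1 = t i₀ ∧ t 2 = t i₀ ∧ n = 3 * t i₀) := by
      have := ht 0; have := ht 1; have := ht 2
      omega
    rcases key with ⟨h0, h1, h2⟩ | ⟨h0, h1, h2, h⟩ | ⟨h0, h1, h2, h⟩ <;>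
      rw [h0, h1, h2] at hparts
    · exact Or.inl ⟨i₀, hparts⟩
    · exact Or.inr (Or.inl ⟨t i₀, h3, h, i₀, hparts⟩)
    · exact Or.inr (Or.inr ⟨t i₀, h3, h, i₀, hparts⟩)
  · rintro (⟨i₀, hp⟩ | ⟨p, hp3, rfl, i₀, hp⟩ | ⟨p, hp3, rfl, i₀, hp⟩)
    all_goals
      refine ⟨_, i₀, hp, ?_⟩
      have h2 := hp.two_le
      fin_cases i₀ <;> simp [Fin.forall_fin_succ] at h2 ⊢ <;> omega

end Lists

theorem hasParts_completeSplit_sub_three {n : ℕ} (hn : 6 ≤ n) :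
    HasParts (completeSplit n (n - 3)) ![n - 3, 1, 1, 1] := by
  have h := hasParts_completeSplit (n := n) (α := n - 3) (k := 3) (by omega)
  convert h using 1
  ext i
  fin_cases i <;> rfl

theorem hasParts_completeSplit_sub_two {n : ℕ} (hn : 6 ≤ n) :
    HasParts (completeSplit n (n - 2)) ![n - 2, 1, 1] := by
  have h := hasParts_completeSplit (n := n) (α := n - 2) (k := 2) (by omega)
  convert h using 1
  ext i
  fin_cases i <;> rfl

/-- The condition on the second smallest eigenvalue follows from the order being an eigenvalue. -/
theorem multiplicity_conditions_iff {V : Type*} [Fintype V] [DecidableEq V] {G : SimpleGraph V}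
    (hG : G.Connected) {n : ℕ} (hcard : Fintype.card V = n) (hn : 6 ≤ n) {m : ℕ} (hm : m ≠ 0)
    (h₀ : 0 < Fintype.card V) (h₂ : n - 2 < Fintype.card V) :
    (multiplicity G (eigenvalue G ⟨0, h₀⟩) = n - 4 ∧
      eigenvalue G ⟨n - 2, h₂⟩ = (n : ℝ) ∧ multiplicity G (n : ℝ) = m) ↔
    (finrank ℝ (eigspace G (eigenvalue G ⟨0, h₀⟩)) + 4 = Fintype.card V ∧
      finrank ℝ (eigspace G (Fintype.card V)) = m) := by
  subst hcard
  unfold multiplicity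
  constructor
  · rintro ⟨h1, -, h3⟩
    exact ⟨by rw [h1]; omega, h3⟩
  · rintro ⟨h1, h3⟩
    refine ⟨Nat.eq_sub_of_add_eq h1, eigenvalue_card_sub_two G hG (by omega) fun hbot => hm ?_, h3⟩
    rw [← h3, hbot, finrank_bot]

end DistLap

open DistLap

theorem theoremT1 {V : Type*} [Fintype V] [DecidableEq V] (G : SimpleGraph V)
    (hG : G.Connected) (n : ℕ) (hcard : Fintype.card V = n) (hn : 6 ≤ n) :
    ((DistLap.multiplicity G (DistLap.eigenvalue G ⟨0, by omega⟩) = n - 4 ∧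
        DistLap.eigenvalue G ⟨n - 2, by omega⟩ = (n : ℝ) ∧
        DistLap.multiplicity G (n : ℝ) = 3) ↔
      ((n ≡ 0 [MOD 4] ∧ Nonempty (G ≃g completeMultipartite ![n / 4, n / 4, n / 4, n / 4])) ∨
        (n ≡ 1 [MOD 3] ∧
          Nonempty (G ≃g completeMultipartite ![(n - 1) / 3, (n - 1) / 3, (n - 1) / 3, 1])) ∨
        (n ≡ 2 [MOD 2] ∧
          Nonempty (G ≃g completeMultipartite ![(n - 2) / 2, (n - 2) / 2, 1, 1])) ∨
        Nonempty (G ≃g completeSplit n (n - 3)))) ∧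
    ((DistLap.multiplicity G (DistLap.eigenvalue G ⟨0, by omega⟩) = n - 4 ∧
        DistLap.eigenvalue G ⟨n - 2, by omega⟩ = (n : ℝ) ∧
        DistLap.multiplicity G (n : ℝ) = 2) ↔
      (IsIsoAddEdge G (completeSplit n (n - 2)) ∨
        Nonempty (G ≃g complThreeCliques (n - 3) 2 1) ∨
        (∃ p : ℕ, 3 ≤ p ∧ n = 2 * p + 1 ∧ IsIsoAddEdge G (completeMultipartite ![p, p, 1])) ∨
        (∃ p : ℕ, 3 ≤ p ∧ n = 2 * p + 2 ∧ Nonempty (G ≃g completeMultipartite ![p, p, 2])) ∨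
        (∃ p : ℕ, 3 ≤ p ∧ n = 3 * p ∧ IsIsoAddEdge G (completeMultipartite ![p, p, p])))) := by
  constructor
  · rw [multiplicity_conditions_iff hG hcard hn (by norm_num),
      multiplicity_three_iff hG (by omega), hasParts_four_iff hcard hn,
      nonempty_iso_iff (hasParts_completeMultipartite _),
      nonempty_iso_iff (hasParts_completeMultipartite _),
      nonempty_iso_iff (hasParts_completeMultipartite _),
      nonempty_iso_iff (hasParts_completeSplit_sub_three hn)]
  · rw [multiplicity_conditions_iff hG hcard hn (by norm_num),
      multiplicity_two_iff hG (by omega), hasParts_three_iff hcard hn,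
      hasPartsAddEdge_three_iff hcard hn,
      isIsoAddEdge_iff (hasParts_completeSplit_sub_two hn),
      nonempty_iso_iff (hasParts_complThreeCliques _ _ _)]
    simp only [nonempty_iso_iff (hasParts_completeMultipartite _),
      isIsoAddEdge_iff (hasParts_completeMultipartite _)]
    have hperm : ∀ P Q R S T : Prop, (P ∨ Q) ∨ R ∨ S ∨ T ↔ R ∨ P ∨ S ∨ Q ∨ T := by tauto
    exact hperm _ _ _ _ _
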